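/- There are absolute constants $c_3>0$ and $C_0>0$ such that the following holds. **Setting.** Let $p,r,n\ge 1$. Let $S^*\in\mathbb R^{p\times p}$ be symmetric positive definite with largest eigenvalue $S_1$ and smallest eigenvalue $S_p$, and let $L^*\in\mathbb R^{p\times p}$ be positive semidefinite of rank at most $r$. Let $X_1,\dots,X_n$ be i.i.d. $\mathcal N(0,(S^*+L^*)^{-1})$, $C=\frac1n\sum_i X_iX_i^T$, and $$F(L)=-\log\det(S^*+L)+\langle S^*+L,C\rangle,\qquad \nabla F(L)=-(S^*+L)^{-1}+C .$$ Let $\mathbb U_k$ be the family of subspaces of $\mathbb R^{p\times p}$ spanned by $k$ atoms $uv^T$ with unit vectors $u,v$; let $P_W$ be the orthogonal projection onto $W$ and $A_k$ a best rank-$k$ approximation of $A$, in Frobenius norm. Fix $c_{\mathcal T}>1$, $0<c_{\mathcal H}<1$ and a step size $\eta$. A run of AP-LVM is a sequence of symmetric matrices with $L^0=0$ and $L^{t+1}=P_{W_t}(b_t)$, $b_t=L^t-\eta P_{V_t}\nabla F(L^t)$, where $V_t\in\mathbb U_{2r}$ and $W_t\in\mathbb U_r$ are arbitrary subspaces with $$\|P_{V_t}\nabla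 F(L^t)\|_F\ge c_{\mathcal H}\|(\nabla F(L^t))_{2r}\|_F\quad\text{and}\quad \|b_t-P_{W_t}b_t\|_F\le c_{\mathcal T}\|b_t-(b_t)_r\|_F .$$ **Constants.** Let $\delta'>0$ and $0<a'\le(1+\sqrt r)\|L^*\|_2+\delta'$, and set $$m_{2r}=\frac1{\left(S_1+(1+\sqrt r)\|L^*\|_2+\delta'\right)^2},\qquad M_{2r}=\frac1{(S_p-a')^2},$$ $$\eta_0=c_{\mathcal H}m_{2r}-\sqrt{1+M_{2r}^2-2m_{2r}},\qquad \rho_0=\frac1{1+c_{\mathcal T}}-\sqrt{1-\eta_0^2},$$ $$\rho_1=\left(\sqrt{1+M_{2r}^2\eta^2-2m_{2r}\eta}+\sqrt{1-\eta_0^2}\right)(1+c_{\mathcal T}),\qquad \rho_2=\left(\frac{\eta_0}{\sqrt{1-\eta_0^2}}+1\right)(1+c_{\mathcal T}).$$ Suppose that $\eta_0>0$, $\rho_1<1$ and $\frac{1-\rho_0^2}{M_{2r}}\le\eta\le\frac{1+\rho_0^2}{m_{2r}}$. **Assumptions.** Assume $$n\ge C_0\,\frac1{\delta'^2}\left(\frac{\rho_2}{1-\rho_1}\right)^2rp,$$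 $$\|L^*\|_2\le\frac1{1+\sqrt r}\left(\frac{S_p}{1+\sqrt{1-\rho_0^2}}-\frac{S_1\sqrt{1-\rho_0^2}}{1+\sqrt{1-\rho_0^2}}-\frac{c_3\rho_2}{1-\rho_1}\sqrt{\frac{rp}n}\right),$$ $$S_p\le S_1\le\frac1{\sqrt{1-\rho_0^2}}(S_p-a')-(1+\sqrt r)\|L^*\|_2-\delta'.$$ **Conclusion.** Then $S_p-a'>0$, $m_{2r}>0$ and $1\le M_{2r}^2/m_{2r}^2\le\frac1{1-\rho_0^2}$. Moreover, let $\mathcal K$ be the set of symmetric $L$ for which all eigenvalues of $S^*+L$ lie in $[\,S_p-a',\ S_1+(1+\sqrt r)\|L^*\|_2+\delta'\,]$. With probability at least $1-2e^{-p}$, the following hold. 1. $F$ satisfies RSC/RSS with constants $m_{2r},M_{2r}$ on $\mathcal K$: for all $L_1,L_2\in\mathcal K$ of rank at most $2r$, $$\frac{m_{2r}}2\|L_2-L_1\|_F^2\le F(L_2)-F(L_1)-\langle\nabla F(L_1),L_2-L_1\rangle\le\frac{M_{2r}}2\|L_2-L_1\|_F^2 .$$ 2. $L^*\in\mathcal K$,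 and for every run of AP-LVM and every $T\ge0$, all iterates $L^0,\dots,L^T$ lie in $\mathcal K$, provided that $-a'$ is a lower bound for the eigenvalues of $L^0,\dots,L^T$. This proviso is not needed if $a'\ge(1+\sqrt r)\|L^*\|_2+\frac{c_3\rho_2}{1-\rho_1}\sqrt{rp/n}$. -/

import Mathlib

open MeasureTheory ProbabilityTheory
open scoped Matrix

noncomputable section

namespace LVM

/-- Real `p × p` matrices. -/
abbrev Mat (p : ℕ) : Type := Matrix (Fin p) (Fin p) ℝ

variable {p : ℕ}

/-! ### Norms, eigenvalues, projections -/

/-- The Frobenius (trace) inner product `⟨A, B⟩ = ∑ᵢⱼ Aᵢⱼ Bᵢⱼ`. -/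
def frobInner (A B : Mat p) : ℝ := ∑ i, ∑ j, A i j * B i j

/-- The Frobenius norm `‖A‖_F`. -/
def frobNorm (A : Mat p) : ℝ := Real.sqrt (frobInner A A)

/-- The spectral norm `‖A‖₂`, i.e. the operator norm for the Euclidean norm on `ℝ^p`. -/
def specNorm (A : Mat p) : ℝ := ‖Matrix.toEuclideanCLM (n := Fin p) (𝕜 := ℝ) A‖

/-- The largest eigenvalue `λ₁(A)` (used for symmetric matrices of positive size). -/
def lamMax (A : Mat p) : ℝ := sSup (spectrum ℝ A)

/-- The smallest eigenvalue `λ_p(A)` (used for symmetric matrices of positive size). -/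
def lamMin (A : Mat p) : ℝ := sInf (spectrum ℝ A)

/-- A matrix, read entry by entry as a point of the Euclidean space `ℝ^(p × p)`. -/
def toEuc : Mat p ≃ₗ[ℝ] EuclideanSpace ℝ (Fin p × Fin p) :=
  (LinearEquiv.curry ℝ ℝ (Fin p) (Fin p)).symm ≪≫ₗ
    (WithLp.linearEquiv 2 ℝ (Fin p × Fin p → ℝ)).symm

/-- The orthogonal projection `P_W A` of the matrix `A` onto the subspace `W` of `ℝ^(p × p)`. -/
def proj (W : Submodule ℝ (Mat p)) (A : Mat p) : Mat p :=
  toEuc.symm ((W.map (toEuc (p := p)).toLinearMap).starProjection (toEuc A))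

theorem inner_toEuc (A B : Mat p) : inner ℝ (toEuc A) (toEuc B) = frobInner A B := by
  simp only [PiLp.inner_apply, frobInner, Fintype.sum_prod_type]
  refine Finset.sum_congr rfl fun i _ => Finset.sum_congr rfl fun j _ => ?_
  change B i j * A i j = A i j * B i j
  exact mul_comm _ _

theorem proj_mem (W : Submodule ℝ (Mat p)) (A : Mat p) : proj W A ∈ W := by
  have h := Submodule.starProjection_apply_mem
    (W.map (toEuc (p := p)).toLinearMap) (toEuc A)
  obtain ⟨B, hB, hBA⟩ := h
  have : proj W A = B := by
    unfold proj
    rw [← hBA]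
    simp
  rw [this]
  exact hB

theorem frobInner_sub_proj (W : Submodule ℝ (Mat p)) (A : Mat p) {B : Mat p} (hB : B ∈ W) :
    frobInner (A - proj W A) B = 0 := by
  rw [← inner_toEuc, map_sub]
  have h := Submodule.starProjection_inner_eq_zero (K := W.map (toEuc (p := p)).toLinearMap)
    (toEuc A) (toEuc B) ⟨B, hB, rfl⟩
  simpa [proj] using h

/-! ### Low-rank subspaces, approximate head and tail projections -/

/-- The family `𝕌_k` of subspaces of `ℝ^(p × p)` that are spanned by `k` atoms `u vᵀ` with
`u`, `v` unit vectors. -/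
def lowRankSubspaces (p k : ℕ) : Set (Submodule ℝ (Mat p)) :=
  {W | ∃ u v : Fin k → EuclideanSpace ℝ (Fin p), (∀ i, ‖u i‖ = 1) ∧ (∀ i, ‖v i‖ = 1) ∧
    W = Submodule.span ℝ (Set.range fun i => Matrix.vecMulVec (u i).ofLp (v i).ofLp)}

/-- `B` is a best rank-`k` approximation `A_k` of `A` in Frobenius norm. -/
def IsBestApprox (k : ℕ) (A B : Mat p) : Prop :=
  B.rank ≤ k ∧ ∀ D : Mat p, D.rank ≤ k → frobNorm (A - B) ≤ frobNorm (A - D)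

/-- `W` is an admissible output, on input `A`, of a `cT`-approximate tail projection of rank
`k`: `W ∈ 𝕌_k` and `‖A - P_W A‖_F ≤ cT ‖A - A_k‖_F`. -/
def IsTail (cT : ℝ) (k : ℕ) (A : Mat p) (W : Submodule ℝ (Mat p)) : Prop :=
  W ∈ lowRankSubspaces p k ∧
    ∀ B, IsBestApprox k A B → frobNorm (A - proj W A) ≤ cT * frobNorm (A - B)

/-- `V` is an admissible output, on input `A`, of a `cH`-approximate head projection of rank
`k`: `V ∈ 𝕌_k` and `‖P_V A‖_F ≥ cH ‖A_k‖_F`. -/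
def IsHead (cH : ℝ) (k : ℕ) (A : Mat p) (V : Submodule ℝ (Mat p)) : Prop :=
  V ∈ lowRankSubspaces p k ∧
    ∀ B, IsBestApprox k A B → cH * frobNorm B ≤ frobNorm (proj V A)

/-! ### The objective function -/

/-- The sample covariance matrix `C = (1/n) ∑ᵢ xᵢ xᵢᵀ`. -/
def sampleCov {n : ℕ} (x : Fin n → EuclideanSpace ℝ (Fin p)) : Mat p :=
  (1 / (n : ℝ)) • ∑ i, Matrix.vecMulVec (x i).ofLp (x i).ofLp

/-- `F(L) = - log det (S + L) + ⟨S + L, C⟩`; used only where `S + L` is positive definite. -/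
def obj (S C L : Mat p) : ℝ := -Real.log (S + L).det + frobInner (S + L) C

/-- `∇F(L) = -(S + L)⁻¹ + C`. -/
def gradObj (S C L : Mat p) : Mat p := -(S + L)⁻¹ + C

/-- `f`, with gradient `g`, satisfies the RSC / RSS conditions at rank `k` with constants
`m`, `M` for matrices in the set `K`. -/
def RSCRSSOn (K : Set (Mat p)) (k : ℕ) (f : Mat p → ℝ) (g : Mat p → Mat p) (m M : ℝ) : Prop :=
  ∀ L₁ ∈ K, ∀ L₂ ∈ K, L₁.rank ≤ k → L₂.rank ≤ k →
    m / 2 * frobNorm (L₂ - L₁) ^ 2 ≤ f L₂ - f L₁ - frobInner (g L₁) (L₂ - L₁) ∧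
    f L₂ - f L₁ - frobInner (g L₁) (L₂ - L₁) ≤ M / 2 * frobNorm (L₂ - L₁) ^ 2

/-- The symmetric matrices `L` such that all eigenvalues of `S + L` are in `[lo, hi]`. -/
def specBox (S : Mat p) (lo hi : ℝ) : Set (Mat p) :=
  {L | L.IsSymm ∧ (S + L - lo • (1 : Mat p)).PosSemidef ∧
    (hi • (1 : Mat p) - (S + L)).PosSemidef}

/-! ### The algorithm AP-LVM -/

/-- `L⁰, L¹, …` is a run of AP-LVM with symmetric iterates:
`L⁰ = 0` and `L^{t+1} = 𝒯(L^t - η ℋ(∇F(L^t)))`, where `ℋ(∇F(L^t))` is the projection of the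
gradient on a `cH`-approximate head subspace of rank `2r`, and `𝒯` is the projection on a
`cT`-approximate tail subspace of rank `r`. The subspaces are otherwise arbitrary. -/
def IsAPLVMRun (S C : Mat p) (r : ℕ) (η cT cH : ℝ) (L : ℕ → Mat p) : Prop :=
  L 0 = 0 ∧ ∀ t, (L t).IsSymm ∧
    ∃ V W : Submodule ℝ (Mat p),
      IsHead cH (2 * r) (gradObj S C (L t)) V ∧
      IsTail cT r (L t - η • proj V (gradObj S C (L t))) W ∧
      L (t + 1) = proj W (L t - η • proj V (gradObj S C (L t)))

/-! ### The parameters of the convergence rate -/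

/-- `η₀ = c_H m - √(1 + M² - 2m)`. -/
def eta0 (cH m M : ℝ) : ℝ := cH * m - Real.sqrt (1 + M ^ 2 - 2 * m)

/-- `ρ₀ = 1 / (1 + c_T) - √(1 - η₀²)`. -/
def rho0 (cT cH m M : ℝ) : ℝ := 1 / (1 + cT) - Real.sqrt (1 - eta0 cH m M ^ 2)

/-- `ρ₁ = (√(1 + M² η² - 2 m η) + √(1 - η₀²)) (1 + c_T)`. -/
def rho1 (cT cH m M η : ℝ) : ℝ :=
  (Real.sqrt (1 + M ^ 2 * η ^ 2 - 2 * m * η) + Real.sqrt (1 - eta0 cH m M ^ 2)) * (1 + cT)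

/-- `ρ₂ = (η₀ / √(1 - η₀²) + 1) (1 + c_T)`. -/
def rho2 (cT cH m M : ℝ) : ℝ :=
  (eta0 cH m M / Real.sqrt (1 - eta0 cH m M ^ 2) + 1) * (1 + cT)

end LVM

end

noncomputable section

namespace LVM

variable {p : ℕ}

/-! The argument rests on the identity ∇F(L) - ∇F(L*) = (S+L*)⁻¹ (L-L*) (S+L)⁻¹. If both S+L* and
S+L have spectrum in [lo, hi], then R : X ↦ (S+L*)⁻¹ X (S+L)⁻¹ is symmetric for the Frobenius inner
product, with spectrum in [m, M] = [1/hi², 1/lo²]. The same bounds along a segment of the box give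
RSC/RSS deterministically and without any rank restriction (`rscrssOn_obj`).

For the iterates, put x = L - L* and e = ∇F(L*) = C - (S+L*)⁻¹, so that the gradient at L is R x +
e. The noise e is only ever paired with matrices of rank at most 2r, and so costs √(2r)‖e‖₂
(`abs_frobInner_le_of_rank_le`). Up to noise, the head subspace misses at most √(1-η₀²)‖x‖ of x, the
gradient step contracts by √(1+M²η²-2mη), and the tail projection loses a factor 1+c_T. Together
these say that one step sends a distance d to at most ρ₁ d + ρ₂ · noise (`frobNorm_step_le`).

With ε = c₃ρ₂/(1-ρ₁)·√(rp/n), the Frobenius ball of radius √r‖L*‖₂ + ε around L* contains L⁰ = 0 and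
is preserved by a step taken inside the box. Since ε ≤ δ', the ball respects the upper end of the
box; the lower end comes from the size of a' or from the proviso (`IsAPLVMRun.mem_specBox`).

Probability enters only through ‖C - (S+L*)⁻¹‖₂ ≲ lo⁻¹√(p/n), proved by a chi-square Chernoff bound
on a net of the sphere (`sampleCov_concentration`). A step amplifies noise by at most 4·lo, which
cancels lo⁻¹ and makes c₃ absolute. That bound on the amplification uses η₀ > 0, which forces m >
1/2, and hi² ≤ (4/3) lo², which comes from ρ₀ < 1/2. -/

/-! ### Frobenius and spectral norms on matrices of bounded rank. -/

theorem norm_toEuc (A : Mat p) : ‖toEuc A‖ = frobNorm A := by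
  rw [frobNorm, ← inner_toEuc, norm_eq_sqrt_real_inner]

theorem frobInner_eq_trace (A B : Mat p) : frobInner A B = (Aᵀ * B).trace := by
  simp only [frobInner, Matrix.trace, Matrix.diag_apply, Matrix.mul_apply, Matrix.transpose_apply]
  exact Finset.sum_comm

theorem toEuc_proj (W : Submodule ℝ (Mat p)) (A : Mat p) :
    toEuc (proj W A) = (W.map (toEuc (p := p)).toLinearMap).starProjection (toEuc A) := by
  simp [proj]

theorem frobInner_smul_left (c : ℝ) (A B : Mat p) : frobInner (c • A) B = c * frobInner A B := by
  rw [← inner_toEuc, ← inner_toEuc, map_smul, real_inner_smul_left]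

theorem frobNorm_sq (A : Mat p) : frobNorm A ^ 2 = frobInner A A := by
  rw [← norm_toEuc, ← inner_toEuc, real_inner_self_eq_norm_sq]

theorem frobNorm_nonneg (A : Mat p) : 0 ≤ frobNorm A := Real.sqrt_nonneg _

theorem specNorm_nonneg (A : Mat p) : 0 ≤ specNorm A := norm_nonneg _

/-- The `j`-th column of a matrix as a Euclidean vector. -/
def euclideanCol (A : Mat p) (j : Fin p) : EuclideanSpace ℝ (Fin p) := WithLp.toLp 2 (A.col j)

theorem frobInner_eq_sum_inner_col (A B : Mat p) :
    frobInner A B = ∑ j, inner ℝ (euclideanCol A j) (euclideanCol B j) := by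
  simp only [frobInner, euclideanCol, PiLp.inner_apply]
  rw [Finset.sum_comm]
  refine Finset.sum_congr rfl fun j _ => Finset.sum_congr rfl fun i _ => ?_
  simp [mul_comm]

theorem frobNorm_sq_eq_sum_norm_col (A : Mat p) :
    frobNorm A ^ 2 = ∑ j, ‖euclideanCol A j‖ ^ 2 := by
  simp [frobNorm_sq, frobInner_eq_sum_inner_col]

theorem specNorm_le_frobNorm (A : Mat p) : specNorm A ≤ frobNorm A := by
  refine ContinuousLinearMap.opNorm_le_bound _ (frobNorm_nonneg A) fun x => ?_
  refine abs_le_of_sq_le_sq' ?_ (mul_nonneg (frobNorm_nonneg A) (norm_nonneg x)) |>.2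
  rw [mul_pow, frobNorm_sq, EuclideanSpace.real_norm_sq_eq, EuclideanSpace.real_norm_sq_eq,
    frobInner, Finset.sum_mul]
  refine Finset.sum_le_sum fun i _ => ?_
  have := Finset.sum_mul_sq_le_sq_mul_sq Finset.univ (fun j => A i j) (fun j => x j)
  simpa [Matrix.mulVec, dotProduct, sq] using this

theorem norm_mulVec_le_specNorm (A : Mat p) (x : EuclideanSpace ℝ (Fin p)) :
    ‖Matrix.toEuclideanCLM (n := Fin p) (𝕜 := ℝ) A x‖ ≤ specNorm A * ‖x‖ :=
  ContinuousLinearMap.le_opNorm _ _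

theorem specNorm_transpose (A : Mat p) : specNorm Aᵀ = specNorm A := by
  have h : Matrix.toEuclideanCLM (n := Fin p) (𝕜 := ℝ) Aᵀ =
      star (Matrix.toEuclideanCLM (n := Fin p) (𝕜 := ℝ) A) := by
    rw [← map_star, Matrix.star_eq_conjTranspose, Matrix.conjTranspose_eq_transpose_of_trivial]
  rw [specNorm, h]
  exact norm_star (E := EuclideanSpace ℝ (Fin p) →L[ℝ] EuclideanSpace ℝ (Fin p)) _

theorem inner_euclideanCol (A : Mat p) (b : EuclideanSpace ℝ (Fin p)) (j : Fin p) :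
    inner ℝ b (euclideanCol A j) = Matrix.toEuclideanCLM (n := Fin p) (𝕜 := ℝ) Aᵀ b j := by
  simp [euclideanCol, PiLp.inner_apply, Matrix.mulVec, dotProduct]

/-- Duality of the spectral and nuclear norms for low-rank matrices. -/
theorem abs_frobInner_le_of_rank_le (G : Mat p) {Z : Mat p} {k : ℕ} (hZ : Z.rank ≤ k) :
    |frobInner G Z| ≤ Real.sqrt k * specNorm G * frobNorm Z := by
  -- T is the column space of Z. Only the projection of G to T pairs with Z, and its squared
  -- Frobenius norm, computed in an orthonormal basis of T, is a sum of at most k terms ‖Gᵀbᵢ‖² ≤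
  -- ‖G‖₂².
  let T : Submodule ℝ (EuclideanSpace ℝ (Fin p)) :=
    LinearMap.range (Matrix.toEuclideanLin Z)
  have hT : Module.finrank ℝ T ≤ k := by
    refine le_trans (le_of_eq ?_) hZ
    rw [Matrix.rank_eq_finrank_range_toLin Z (EuclideanSpace.basisFun (Fin p) ℝ).toBasis
      (EuclideanSpace.basisFun (Fin p) ℝ).toBasis]
    congr 2
  let b := stdOrthonormalBasis ℝ T
  have hcol (j : Fin p) : euclideanCol Z j ∈ T := ⟨EuclideanSpace.single j 1, by
    ext i; simp [euclideanCol]⟩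
  have h1 : frobInner G Z =
      ∑ j, inner ℝ (T.starProjection (euclideanCol G j)) (euclideanCol Z j) := by
    rw [frobInner_eq_sum_inner_col]
    refine Finset.sum_congr rfl fun j _ => ?_
    rw [Submodule.inner_starProjection_left_eq_right,
      Submodule.starProjection_eq_self_iff.2 (hcol j)]
  have h2 : ∑ j, ‖T.starProjection (euclideanCol G j)‖ ^ 2 ≤ k * specNorm G ^ 2 := by
    have h3 (j : Fin p) : ‖T.starProjection (euclideanCol G j)‖ ^ 2 =
        ∑ i, (Matrix.toEuclideanCLM (n := Fin p) (𝕜 := ℝ) Gᵀ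
          (b i : EuclideanSpace ℝ (Fin p)) j) ^ 2 := by
      have : ‖T.starProjection (euclideanCol G j)‖ =
          ‖T.orthogonalProjectionOnto (euclideanCol G j)‖ := rfl
      rw [this, ← b.sum_sq_inner_right]
      refine Finset.sum_congr rfl fun i _ => ?_
      rw [← inner_euclideanCol, Submodule.inner_orthogonalProjectionOnto_eq_of_mem_left]
    simp_rw [h3]
    rw [Finset.sum_comm]
    simp_rw [← EuclideanSpace.real_norm_sq_eq]
    calc _ ≤ ∑ i : Fin (Module.finrank ℝ T), specNorm G ^ 2 := by
          refine Finset.sum_le_sum fun i _ => ?_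
          have h4 := norm_mulVec_le_specNorm Gᵀ (b i : EuclideanSpace ℝ (Fin p))
          have h5 : ‖(b i : EuclideanSpace ℝ (Fin p))‖ = 1 := b.norm_eq_one i
          rw [h5, mul_one, specNorm_transpose] at h4
          gcongr
      _ ≤ k * specNorm G ^ 2 := by
          simp only [Finset.sum_const, Finset.card_univ, Fintype.card_fin, nsmul_eq_mul]
          gcongr
  have h6 : |frobInner G Z| ≤
      ∑ j, ‖T.starProjection (euclideanCol G j)‖ * ‖euclideanCol Z j‖ := by
    rw [h1]
    exact (Finset.abs_sum_le_sum_abs _ _).trans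
      (Finset.sum_le_sum fun j _ => abs_real_inner_le_norm _ _)
  refine h6.trans (abs_le_of_sq_le_sq' ?_ (mul_nonneg (mul_nonneg (Real.sqrt_nonneg _)
    (specNorm_nonneg _)) (frobNorm_nonneg _))).2
  refine (Finset.sum_mul_sq_le_sq_mul_sq _ _ _).trans ?_
  rw [mul_pow, mul_pow, Real.sq_sqrt (Nat.cast_nonneg k), frobNorm_sq_eq_sum_norm_col]
  gcongr

theorem frobNorm_le_of_rank_le {Z : Mat p} {k : ℕ} (hZ : Z.rank ≤ k) :
    frobNorm Z ≤ Real.sqrt k * specNorm Z := by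
  have h := abs_frobInner_le_of_rank_le Z hZ
  rw [← frobNorm_sq, abs_of_nonneg (sq_nonneg _), sq] at h
  rcases (frobNorm_nonneg Z).eq_or_lt with h0 | h0
  · rw [← h0]
    exact mul_nonneg (Real.sqrt_nonneg _) (specNorm_nonneg _)
  · exact le_of_mul_le_mul_right h h0

/-! ### Best low-rank approximations. -/

theorem rank_le_of_mem_lowRankSubspaces {k : ℕ} {W : Submodule ℝ (Mat p)}
    (hW : W ∈ lowRankSubspaces p k) {A : Mat p} (hA : A ∈ W) : A.rank ≤ k := by
  obtain ⟨u, v, -, -, rfl⟩ := hW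
  obtain ⟨c, rfl⟩ := (Submodule.mem_span_range_iff_exists_fun ℝ).1 hA
  have : ∑ i, c i • Matrix.vecMulVec (u i).ofLp (v i).ofLp =
      (Matrix.of fun a i => c i * (u i).ofLp a) * (Matrix.of fun i b => (v i).ofLp b) := by
    ext a b
    simp [Matrix.sum_apply, Matrix.mul_apply, Matrix.vecMulVec_apply, mul_assoc]
  rw [this]
  refine (Matrix.rank_mul_le_left _ _).trans ((Matrix.rank_le_card_width _).trans (by simp))

theorem rank_smul_le (c : ℝ) (A : Mat p) : (c • A).rank ≤ A.rank := by
  have : c • A = A * (c • (1 : Mat p)) := by simp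
  rw [this]
  exact Matrix.rank_mul_le_left _ _

theorem isClosed_rank_le (k : ℕ) : IsClosed {A : Mat p | A.rank ≤ k} := by
  have h := isOpen_setOfPred_nat_le_rank (𝕜 := ℝ) (E := EuclideanSpace ℝ (Fin p))
    (F := EuclideanSpace ℝ (Fin p)) (k + 1)
  have hc : Continuous fun A : Mat p => Matrix.toEuclideanCLM (n := Fin p) (𝕜 := ℝ) A :=
    LinearMap.continuous_of_finiteDimensional
      (Matrix.toEuclideanCLM (n := Fin p) (𝕜 := ℝ)).toAlgEquiv.toLinearMap
  have h2 := (h.preimage hc).isClosed_compl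
  convert h2 using 1
  ext A
  have h3 : A.rank = Module.finrank ℝ (LinearMap.range (Matrix.toEuclideanLin A)) := by
    rw [Matrix.rank_eq_finrank_range_toLin A (EuclideanSpace.basisFun (Fin p) ℝ).toBasis
      (EuclideanSpace.basisFun (Fin p) ℝ).toBasis]
    congr 2
  have h4 : ((Matrix.toEuclideanCLM (n := Fin p) (𝕜 := ℝ) A :
      EuclideanSpace ℝ (Fin p) →L[ℝ] EuclideanSpace ℝ (Fin p)) :
      EuclideanSpace ℝ (Fin p) →ₗ[ℝ] EuclideanSpace ℝ (Fin p)).rank = (A.rank : Cardinal) := by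
    rw [h3, Module.finrank_eq_rank]
    rfl
  simp only [Set.mem_compl_iff, Set.mem_preimage]
  change A.rank ≤ k ↔ ¬ ((k + 1 : ℕ) : Cardinal) ≤ _
  rw [h4, Nat.cast_le]
  omega

/-- The inequalities in `IsHead` and `IsTail` quantify over best approximations and would be vacuous
without this. Rank is lower semicontinuous, so the distance to the closed set of matrices of rank at
most k is attained. -/
theorem exists_isBestApprox (k : ℕ) (A : Mat p) : ∃ B, IsBestApprox k A B := by
  let s : Set (EuclideanSpace ℝ (Fin p × Fin p)) := toEuc '' {A : Mat p | A.rank ≤ k}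
  have hs : IsClosed s := by
    have : s = toEuc.symm ⁻¹' {A : Mat p | A.rank ≤ k} := by
      exact LinearEquiv.image_eq_preimage_symm _ _
    rw [this]
    exact (isClosed_rank_le k).preimage
      (LinearMap.continuous_of_finiteDimensional (toEuc (p := p)).symm.toLinearMap)
  obtain ⟨y, ⟨B, hB, rfl⟩, hy⟩ := hs.exists_infDist_eq_dist
    ⟨toEuc 0, 0, by simp, rfl⟩ (toEuc A)
  refine ⟨B, hB, fun D hD => ?_⟩
  rw [← norm_toEuc, ← norm_toEuc, map_sub, map_sub, ← dist_eq_norm, ← dist_eq_norm, ← hy]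
  exact Metric.infDist_le_dist_of_mem ⟨D, hD, rfl⟩

/-- The Frobenius norm of a best rank-`k` approximation dominates the normalised inner product
with any matrix of rank at most `k`. -/
theorem IsBestApprox.frobInner_le {k : ℕ} {A B : Mat p} (h : IsBestApprox k A B) {D : Mat p}
    (hD : D.rank ≤ k) : frobInner A D ≤ frobNorm B * frobNorm D := by
  -- Bounded rank is stable under scaling, so every t • E competes with B. Optimizing over t first
  -- with E = B gives ⟨A, B⟩ ≤ ‖B‖², hence ‖A-B‖² ≥ ‖A‖² - ‖B‖²; optimizing with E = D then gives
  -- ⟨A, D⟩² ≤ ‖B‖²‖D‖².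
  have key (E : Mat p) (hE : E.rank ≤ k) (t : ℝ) :
      ‖toEuc A - toEuc B‖ ^ 2 ≤ ‖toEuc A‖ ^ 2 - 2 * t * inner ℝ (toEuc A) (toEuc E)
        + t ^ 2 * ‖toEuc E‖ ^ 2 := by
    have h1 := h.2 (t • E) ((rank_smul_le t E).trans hE)
    rw [← norm_toEuc, ← norm_toEuc, map_sub, map_sub, map_smul] at h1
    have h2 := pow_le_pow_left₀ (norm_nonneg _) h1 2
    rw [norm_sub_sq_real (toEuc A) (t • toEuc E), real_inner_smul_right, norm_smul, mul_pow,
      Real.norm_eq_abs, sq_abs] at h2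
    linarith
  rw [← inner_toEuc, ← norm_toEuc, ← norm_toEuc]
  have hsub := norm_sub_sq_real (toEuc A) (toEuc B)
  have hAB : inner ℝ (toEuc A) (toEuc B) ≤ ‖toEuc B‖ ^ 2 := by
    by_contra! hlt
    have hB0 : 0 < ‖toEuc B‖ ^ 2 := by
      rcases (sq_nonneg ‖toEuc B‖).eq_or_lt with h0 | h0
      · have : toEuc B = 0 := by simpa using h0.symm
        simp [this] at hlt
      · exact h0
    have h1 := key B h.1 (inner ℝ (toEuc A) (toEuc B) / ‖toEuc B‖ ^ 2)
    have h2 := key B h.1 1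
    have h3 : inner ℝ (toEuc A) (toEuc B) / ‖toEuc B‖ ^ 2 * ‖toEuc B‖ ^ 2 =
      inner ℝ (toEuc A) (toEuc B) := div_mul_cancel₀ _ hB0.ne'
    nlinarith [sq_nonneg (inner ℝ (toEuc A) (toEuc B) / ‖toEuc B‖ ^ 2 - 1),
      (one_lt_div hB0).2 hlt]
  rcases (norm_nonneg (toEuc D)).eq_or_lt with h0 | h0
  · have : toEuc D = 0 := by simpa using h0.symm
    simp [this]
  · have h1 := key D hD (inner ℝ (toEuc A) (toEuc D) / ‖toEuc D‖ ^ 2)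
    have h3 : inner ℝ (toEuc A) (toEuc D) / ‖toEuc D‖ ^ 2 * ‖toEuc D‖ ^ 2 =
      inner ℝ (toEuc A) (toEuc D) := div_mul_cancel₀ _ (by positivity)
    have h4 : inner ℝ (toEuc A) (toEuc D) / ‖toEuc D‖ ^ 2 * inner ℝ (toEuc A) (toEuc D) ≤
        ‖toEuc B‖ ^ 2 := by
      have h6 := congrArg (inner ℝ (toEuc A) (toEuc D) / ‖toEuc D‖ ^ 2 * ·) h3
      linarith
    have h5 : inner ℝ (toEuc A) (toEuc D) ^ 2 ≤ (‖toEuc B‖ * ‖toEuc D‖) ^ 2 := by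
      rw [mul_pow]
      calc _ = inner ℝ (toEuc A) (toEuc D) / ‖toEuc D‖ ^ 2 * inner ℝ (toEuc A) (toEuc D)
            * ‖toEuc D‖ ^ 2 := by linear_combination (-inner ℝ (toEuc A) (toEuc D)) * h3
        _ ≤ _ := by gcongr
    exact (abs_le_of_sq_le_sq' h5 (by positivity)).2


/-! ### Spectral bounds in the Loewner order. -/

theorem posSemidef_sub_smul_one {A : Mat p} (hA : A.IsSymm) {c : ℝ}
    (hc : ∀ x ∈ spectrum ℝ A, c ≤ x) : (A - c • (1 : Mat p)).PosSemidef := by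
  have hA' : A.IsHermitian := by
    rwa [Matrix.IsHermitian, Matrix.conjTranspose_eq_transpose_of_trivial]
  rw [Matrix.posSemidef_iff_isHermitian_and_spectrum_nonneg]
  refine ⟨hA'.sub (by simp [Matrix.IsHermitian]), ?_⟩
  have := spectrum.sub_singleton_eq A c
  rw [Algebra.algebraMap_eq_smul_one] at this
  rw [← this]
  rintro x ⟨y, hy, z, rfl, rfl⟩
  simpa using hc y hy

theorem posSemidef_smul_one_sub {A : Mat p} (hA : A.IsSymm) {c : ℝ}
    (hc : ∀ x ∈ spectrum ℝ A, x ≤ c) : (c • (1 : Mat p) - A).PosSemidef := by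
  have hA' : A.IsHermitian := by
    rwa [Matrix.IsHermitian, Matrix.conjTranspose_eq_transpose_of_trivial]
  rw [Matrix.posSemidef_iff_isHermitian_and_spectrum_nonneg]
  refine ⟨Matrix.IsHermitian.sub (by simp [Matrix.IsHermitian]) hA', ?_⟩
  have := spectrum.singleton_sub_eq A c
  rw [Algebra.algebraMap_eq_smul_one] at this
  rw [← this]
  rintro x ⟨z, rfl, y, hy, rfl⟩
  simpa using hc y hy

theorem finite_spectrum (A : Mat p) : (spectrum ℝ A).Finite := Matrix.finite_real_spectrum

theorem posSemidef_sub_lamMin {A : Mat p} (hA : A.IsSymm) :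
    (A - lamMin A • (1 : Mat p)).PosSemidef :=
  posSemidef_sub_smul_one hA fun _ hx => csInf_le (finite_spectrum A).bddBelow hx

theorem posSemidef_lamMax_sub {A : Mat p} (hA : A.IsSymm) :
    (lamMax A • (1 : Mat p) - A).PosSemidef :=
  posSemidef_smul_one_sub hA fun _ hx => le_csSup (finite_spectrum A).bddAbove hx

theorem spectrum_nonempty (hp : 1 ≤ p) {A : Mat p} (hA : A.IsHermitian) :
    (spectrum ℝ A).Nonempty :=
  ⟨_, hA.eigenvalues_mem_spectrum_real ⟨0, hp⟩⟩

theorem lamMin_pos (hp : 1 ≤ p) {A : Mat p} (hA : A.PosDef) : 0 < lamMin A := by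
  have h := (spectrum_nonempty hp hA.1).csInf_mem (finite_spectrum A)
  rw [hA.1.spectrum_real_eq_range_eigenvalues] at h
  obtain ⟨i, hi⟩ := h
  rw [lamMin, hA.1.spectrum_real_eq_range_eigenvalues, ← hi]
  exact hA.eigenvalues_pos i

theorem lamMin_le_lamMax (hp : 1 ≤ p) {A : Mat p} (hA : A.PosDef) : lamMin A ≤ lamMax A :=
  csInf_le_csSup (spectrum_nonempty hp hA.1) (finite_spectrum A).bddBelow
    (finite_spectrum A).bddAbove

theorem abs_dotProduct_mulVec_le (A : Mat p) (x : Fin p → ℝ) :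
    |x ⬝ᵥ A *ᵥ x| ≤ specNorm A * (x ⬝ᵥ x) := by
  have h := Matrix.inner_toEuclideanCLM A (WithLp.toLp 2 x) (WithLp.toLp 2 x)
  have h1 := abs_real_inner_le_norm (WithLp.toLp 2 x)
    (Matrix.toEuclideanCLM (n := Fin p) (𝕜 := ℝ) A (WithLp.toLp 2 x))
  rw [h] at h1
  have h2 := norm_mulVec_le_specNorm A (WithLp.toLp 2 x)
  have h3 : ‖(WithLp.toLp 2 x : EuclideanSpace ℝ (Fin p))‖ ^ 2 = x ⬝ᵥ x := by
    rw [EuclideanSpace.real_norm_sq_eq]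
    simp [dotProduct, sq]
  have h4 := mul_le_mul_of_nonneg_left h2 (norm_nonneg (WithLp.toLp 2 x : EuclideanSpace ℝ (Fin p)))
  calc _ ≤ _ := h1
    _ ≤ _ := h4
    _ = _ := by rw [← h3]; ring

theorem posSemidef_of_forall {A : Mat p} (hA : A.IsSymm) (h : ∀ x, 0 ≤ x ⬝ᵥ A *ᵥ x) :
    A.PosSemidef :=
  .of_dotProduct_mulVec_nonneg
    (by rwa [Matrix.IsHermitian, Matrix.conjTranspose_eq_transpose_of_trivial])
    (by simpa using h)

theorem isSymm_smul_one (c : ℝ) : (c • (1 : Mat p)).IsSymm := Matrix.isSymm_one.smul c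

theorem posSemidef_specNorm_sub {A : Mat p} (hA : A.IsSymm) {c : ℝ} (hc : specNorm A ≤ c) :
    (c • (1 : Mat p) - A).PosSemidef := by
  refine posSemidef_of_forall ((isSymm_smul_one c).sub hA) fun x => ?_
  have h := (abs_le.1 (abs_dotProduct_mulVec_le A x)).2
  have h2 : 0 ≤ x ⬝ᵥ x := by simpa using dotProduct_star_self_nonneg x
  have := mul_le_mul_of_nonneg_right hc h2
  simp only [Matrix.sub_mulVec, Matrix.smul_mulVec, Matrix.one_mulVec, dotProduct_sub,
    dotProduct_smul, smul_eq_mul]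
  linarith

theorem posSemidef_add_specNorm {A : Mat p} (hA : A.IsSymm) {c : ℝ} (hc : specNorm A ≤ c) :
    (A + c • (1 : Mat p)).PosSemidef := by
  refine posSemidef_of_forall (hA.add (isSymm_smul_one c)) fun x => ?_
  have h := (abs_le.1 (abs_dotProduct_mulVec_le A x)).1
  have h2 : 0 ≤ x ⬝ᵥ x := by simpa using dotProduct_star_self_nonneg x
  have := mul_le_mul_of_nonneg_right hc h2
  simp only [Matrix.add_mulVec, Matrix.smul_mulVec, Matrix.one_mulVec, dotProduct_add,
    dotProduct_smul, smul_eq_mul]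
  linarith

/-- The eigenvalues of the symmetric matrix `A` lie in `[lo, hi]`. -/
def Between (lo hi : ℝ) (A : Mat p) : Prop :=
  (A - lo • (1 : Mat p)).PosSemidef ∧ (hi • (1 : Mat p) - A).PosSemidef

theorem Between.posDef {lo hi : ℝ} {A : Mat p} (h : Between lo hi A) (hlo : 0 < lo) :
    A.PosDef := by
  have := (Matrix.PosDef.one (n := Fin p) (R := ℝ)).smul hlo |>.posSemidef_add h.1
  simpa using this

theorem Between.combo {lo hi : ℝ} {A B : Mat p} (hA : Between lo hi A) (hB : Between lo hi B)
    {t : ℝ} (h0 : 0 ≤ t) (h1 : t ≤ 1) : Between lo hi (A + t • (B - A)) := by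
  constructor
  · convert (hA.1.smul (sub_nonneg.2 h1)).add (hB.1.smul h0) using 1
    module
  · convert (hA.2.smul (sub_nonneg.2 h1)).add (hB.2.smul h0) using 1
    module

theorem posSemidef_transpose_mul_mul {A : Mat p} (hA : A.PosSemidef) (B : Mat p) :
    (Bᵀ * A * B).PosSemidef := by
  simpa using hA.conjTranspose_mul_mul_same B

/-- Two identities exhibit the differences as sums of positive semidefinite matrices: A⁻¹ - hi⁻¹ =
(A⁻¹ - hi⁻¹) A (A⁻¹ - hi⁻¹) + hi⁻²(hi - A) and lo⁻¹ - A⁻¹ = A⁻¹(A - lo)A⁻¹ + lo⁻¹(1 - lo A⁻¹)². -/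
theorem Between.inv {lo hi : ℝ} {A : Mat p} (h : Between lo hi A) (hlo : 0 < lo) (hhi : 0 < hi) :
    Between hi⁻¹ lo⁻¹ A⁻¹ := by
  have hA := h.posDef hlo
  have hdet : IsUnit A.det := (Matrix.isUnit_iff_isUnit_det A).1 hA.isUnit
  have hAs : (A⁻¹)ᵀ = A⁻¹ := by simpa [Matrix.IsSymm] using hA.inv.1
  have e1 := Matrix.nonsing_inv_mul A hdet
  have e2 := Matrix.mul_nonsing_inv A hdet
  constructor
  · have k1 := posSemidef_transpose_mul_mul hA.posSemidef (A⁻¹ - hi⁻¹ • (1 : Mat p))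
    have k2 := h.2.smul (sq_nonneg hi⁻¹)
    convert k1.add k2 using 1
    simp only [Matrix.transpose_sub, hAs, Matrix.transpose_smul, Matrix.transpose_one, sub_mul,
      mul_sub, e1, e2, smul_mul_assoc, mul_smul_comm, one_mul, mul_one, smul_sub, smul_smul]
    have : hi⁻¹ ^ 2 * hi = hi⁻¹ := by field_simp
    rw [this]
    module
  · have k1 := posSemidef_transpose_mul_mul h.1 A⁻¹
    have k2 := (posSemidef_transpose_mul_mul Matrix.PosSemidef.one (1 - lo • A⁻¹)).smul
      (inv_nonneg.2 hlo.le)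
    convert k1.add k2 using 1
    simp only [Matrix.transpose_sub, hAs, Matrix.transpose_smul, Matrix.transpose_one, sub_mul,
      mul_sub, e1, smul_mul_assoc, mul_smul_comm, one_mul, mul_one, smul_sub, smul_smul]
    have : lo⁻¹ * lo = 1 := inv_mul_cancel₀ hlo.ne'
    have h3 : lo⁻¹ * (lo * lo) = lo := by field_simp
    rw [this, h3]
    module

open scoped MatrixOrder in
theorem trace_mul_nonneg {P Q : Mat p} (hP : P.PosSemidef) (hQ : Q.PosSemidef) :
    0 ≤ (P * Q).trace := by
  have h := CFC.sqrt_mul_sqrt_self Q hQ.nonneg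
  have hs : (CFC.sqrt Q)ᵀ = CFC.sqrt Q := by
    simpa [Matrix.IsSymm] using (Matrix.nonneg_iff_posSemidef.1 (CFC.sqrt_nonneg Q)).1
  have := (posSemidef_transpose_mul_mul hP (CFC.sqrt Q)).trace_nonneg
  rwa [hs, Matrix.trace_mul_comm, ← mul_assoc, h, Matrix.trace_mul_comm] at this

/-- The pairing is tr(Q · XᵀPX). Replace Q by a scalar, using that XᵀPX is positive semidefinite,
and then P by a scalar. -/
theorem frobInner_mul_mul_bounds {a b : ℝ} {P Q : Mat p} (ha : 0 ≤ a) (hab : a ≤ b)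
    (hP : Between a b P) (hQ : Between a b Q) (X : Mat p) :
    a ^ 2 * frobNorm X ^ 2 ≤ frobInner (P * X * Q) X ∧
      frobInner (P * X * Q) X ≤ b ^ 2 * frobNorm X ^ 2 := by
  have hpsd {P : Mat p} (h : Between a b P) : P.PosSemidef := by
    have := h.1.add (Matrix.PosSemidef.one.smul ha)
    simpa using this
  have hQs : Qᵀ = Q := by simpa [Matrix.IsSymm] using (hpsd hQ).1
  have hPs : Pᵀ = P := by simpa [Matrix.IsSymm] using (hpsd hP).1
  have e : frobInner (P * X * Q) X = (Q * (Xᵀ * P * X)).trace := by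
    rw [frobInner_eq_trace, Matrix.transpose_mul, Matrix.transpose_mul, hPs, hQs]
    simp only [mul_assoc]
  have n1 := trace_mul_nonneg hQ.1 (posSemidef_transpose_mul_mul (hpsd hP) X)
  have n2 := trace_mul_nonneg hQ.2 (posSemidef_transpose_mul_mul (hpsd hP) X)
  have n3 := (posSemidef_transpose_mul_mul hP.1 X).trace_nonneg
  have n4 := (posSemidef_transpose_mul_mul hP.2 X).trace_nonneg
  simp only [sub_mul, mul_sub, Matrix.trace_sub, smul_mul_assoc, mul_smul_comm, one_mul, mul_one,
    Matrix.trace_smul, smul_eq_mul] at n1 n2 n3 n4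
  rw [e, frobNorm_sq, frobInner_eq_trace]
  constructor <;> nlinarith

theorem frobInner_mul_mul_comm {P Q : Mat p} (hP : Pᵀ = P) (hQ : Qᵀ = Q) (X Y : Mat p) :
    frobInner (P * X * Q) Y = frobInner X (P * Y * Q) := by
  rw [frobInner_eq_trace, frobInner_eq_trace, Matrix.transpose_mul, Matrix.transpose_mul, hP, hQ,
    mul_assoc, Matrix.trace_mul_comm]
  simp only [mul_assoc]

/-! ### Derivative of log det; restricted convexity and smoothness. -/

theorem inv_sub_inv {A B : Mat p} (hA : A.PosDef) (hB : B.PosDef) :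
    A⁻¹ - B⁻¹ = A⁻¹ * (B - A) * B⁻¹ := by
  have hA' := Matrix.nonsing_inv_mul A ((Matrix.isUnit_iff_isUnit_det A).1 hA.isUnit)
  have hB' := Matrix.mul_nonsing_inv B ((Matrix.isUnit_iff_isUnit_det B).1 hB.isUnit)
  rw [mul_sub, sub_mul, mul_assoc, hB', hA', mul_one, one_mul]

theorem hasDerivAt_det_one_add_smul (N : Mat p) :
    HasDerivAt (fun t : ℝ => (1 + t • N).det) N.trace 0 := by
  have h := (Matrix.det (1 + (Polynomial.X : Polynomial ℝ) • N.map Polynomial.C)).hasDerivAt 0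
  rw [Matrix.derivative_det_one_add_X_smul] at h
  refine h.congr_of_eventuallyEq (Filter.Eventually.of_forall fun t => ?_)
  change _ = Polynomial.eval t _
  rw [← Polynomial.coe_evalRingHom, RingHom.map_det]
  refine congrArg Matrix.det (Matrix.ext fun i j => ?_)
  simp only [Matrix.add_apply, Matrix.one_apply, Matrix.smul_apply, smul_eq_mul,
    RingHom.mapMatrix_apply, Matrix.map_apply, Polynomial.coe_evalRingHom, Polynomial.eval_add,
    Polynomial.eval_mul, Polynomial.eval_X, Polynomial.eval_C]
  split_ifs <;> simp

/-- Factoring out B = A + tD gives det(A + sD) = det B · det(1 + (s-t)B⁻¹D), which reduces to the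
derivative of the determinant at the identity. -/
theorem hasDerivAt_log_det {A D : Mat p} {t : ℝ} (h : (A + t • D).PosDef) :
    HasDerivAt (fun s : ℝ => Real.log (A + s • D).det) (frobInner (A + t • D)⁻¹ D) t := by
  set B := A + t • D with hB
  have hu := (Matrix.isUnit_iff_isUnit_det B).1 h.isUnit
  have hBs : (B⁻¹)ᵀ = B⁻¹ := by simpa [Matrix.IsSymm] using h.inv.1
  have e (s : ℝ) : (A + s • D).det = B.det * (1 + (s - t) • (B⁻¹ * D)).det := by
    rw [← Matrix.det_mul, mul_add, mul_one, mul_smul_comm, ← mul_assoc,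
      Matrix.mul_nonsing_inv B hu, one_mul, hB]
    congr 1
    module
  simp_rw [e]
  have h1 : HasDerivAt (fun s : ℝ => (1 + (s - t) • (B⁻¹ * D)).det) (B⁻¹ * D).trace t := by
    have h2 := hasDerivAt_det_one_add_smul (B⁻¹ * D)
    have h3 := (hasDerivAt_id t).sub_const t
    rw [← sub_self t] at h2
    have h4 := HasDerivAt.comp (h₂ := fun s : ℝ => (1 + s • (B⁻¹ * D)).det)
      (h := fun s => id s - t) t h2 h3
    rw [mul_one] at h4
    exact h4
  have h3 := (h1.const_mul B.det).log (by simpa using h.det_pos.ne')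
  convert h3 using 1
  rw [frobInner_eq_trace, hBs]
  simp only [sub_self, zero_smul, add_zero, Matrix.det_one, mul_one]
  field_simp [h.det_pos.ne']

/-- Second-order bounds for a function whose derivative grows at least linearly. -/
theorem half_le_sub_of_deriv {f f' : ℝ → ℝ} {c : ℝ}
    (hf : ∀ t ∈ Set.Icc (0 : ℝ) 1, HasDerivAt f (f' t) t)
    (hc : ∀ t ∈ Set.Icc (0 : ℝ) 1, c * t ≤ f' t - f' 0) : c / 2 ≤ f 1 - f 0 - f' 0 := by
  have hd (t : ℝ) (ht : t ∈ Set.Icc (0 : ℝ) 1) :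
      HasDerivAt (fun t => f t - f' 0 * t - c / 2 * t ^ 2) (f' t - f' 0 - c * t) t := by
    have h := ((hf t ht).sub ((hasDerivAt_id t).const_mul (f' 0))).sub
      (((hasDerivAt_id t).pow 2).const_mul (c / 2))
    refine HasDerivAt.congr_deriv h ?_
    simp only [id, Nat.cast_ofNat]
    ring
  have hmono : MonotoneOn (fun t => f t - f' 0 * t - c / 2 * t ^ 2) (Set.Icc 0 1) := by
    refine monotoneOn_of_deriv_nonneg (convex_Icc 0 1)
      (fun t ht => (hd t ht).continuousAt.continuousWithinAt)
      (fun t ht => (hd t (interior_subset ht)).differentiableAt.differentiableWithinAt)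
      fun t ht => ?_
    rw [(hd t (interior_subset ht)).deriv]
    linarith [hc t (interior_subset ht)]
  have := hmono (Set.left_mem_Icc.2 zero_le_one) (Set.right_mem_Icc.2 zero_le_one) zero_le_one
  simp only [mul_zero, mul_one, one_pow] at this
  linarith

/-- The negative log-likelihood satisfies restricted strong convexity and smoothness on a
spectral box, without any rank restriction. -/
theorem rscrssOn_obj {S C : Mat p} {lo hi : ℝ} (hlo : 0 < lo) (hhi : lo ≤ hi) (k : ℕ) :
    RSCRSSOn (specBox S lo hi) k (obj S C) (gradObj S C) (1 / hi ^ 2) (1 / lo ^ 2) := by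
  intro L₁ h₁ L₂ h₂ _ _
  have hB₁ : Between lo hi (S + L₁) := h₁.2
  have hB₂ : Between lo hi (S + L₂) := h₂.2
  set A := S + L₁ with hA
  set D := L₂ - L₁ with hD
  have hD' : S + L₂ - A = D := by rw [hA, hD]; abel
  have hbt (t : ℝ) (ht : t ∈ Set.Icc (0 : ℝ) 1) : Between lo hi (A + t • D) := by
    rw [← hD']
    exact hB₁.combo hB₂ ht.1 ht.2
  have hder (t : ℝ) (ht : t ∈ Set.Icc (0 : ℝ) 1) :
      HasDerivAt (fun s => -Real.log (A + s • D).det) (-frobInner (A + t • D)⁻¹ D) t :=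
    (hasDerivAt_log_det ((hbt t ht).posDef hlo)).neg
  -- The increment of the derivative is an exact sandwich form by the resolvent identity, so no
  -- second derivative is needed.
  have hdiff (t : ℝ) (ht : t ∈ Set.Icc (0 : ℝ) 1) :
      -frobInner (A + t • D)⁻¹ D - -frobInner (A + (0 : ℝ) • D)⁻¹ D =
        t * frobInner (A⁻¹ * D * (A + t • D)⁻¹) D := by
    have h := inv_sub_inv (hB₁.posDef hlo) ((hbt t ht).posDef hlo)
    rw [add_sub_cancel_left, mul_smul_comm, smul_mul_assoc] at h
    rw [← frobInner_smul_left, ← h, zero_smul, add_zero]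
    simp only [← inner_toEuc]
    rw [map_sub toEuc A⁻¹, inner_sub_left]
    ring
  have hbd (t : ℝ) (ht : t ∈ Set.Icc (0 : ℝ) 1) :=
    frobInner_mul_mul_bounds (inv_nonneg.2 (hlo.trans_le hhi).le)
      (inv_anti₀ hlo hhi) (hB₁.inv hlo (hlo.trans_le hhi))
      ((hbt t ht).inv hlo (hlo.trans_le hhi)) D
  have hlow := half_le_sub_of_deriv (c := hi⁻¹ ^ 2 * frobNorm D ^ 2) hder fun t ht => by
    rw [hdiff t ht, mul_comm]
    exact mul_le_mul_of_nonneg_left (hbd t ht).1 ht.1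
  -- The upper bound is the lower bound for the negated function.
  have hupp := half_le_sub_of_deriv (c := -(lo⁻¹ ^ 2 * frobNorm D ^ 2))
    (fun t ht => (hder t ht).neg) fun t ht => by
    have := mul_le_mul_of_nonneg_left (hbd t ht).2 ht.1
    have h2 := hdiff t ht
    linarith
  have e : obj S C L₂ - obj S C L₁ - frobInner (gradObj S C L₁) D =
      -Real.log (A + (1 : ℝ) • D).det - -Real.log (A + (0 : ℝ) • D).det
        - -frobInner (A + (0 : ℝ) • D)⁻¹ D := by
    have e1 : A + (1 : ℝ) • D = S + L₂ := by rw [hA, hD]; module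
    rw [e1, zero_smul, add_zero, obj, obj, gradObj, ← hA]
    have e2 : S + L₂ = A + D := by rw [hA, hD]; abel
    simp only [← inner_toEuc, e2, map_add, map_neg, inner_add_left, inner_neg_left]
    rw [real_inner_comm (toEuc C) (toEuc D)]
    ring
  rw [e]
  simp only [one_div, inv_pow, Pi.neg_apply] at hlow hupp ⊢
  constructor <;> linarith

/-! ### Gradient steps and projections in a Hilbert space. -/

section Hilbert

variable {E : Type*} [NormedAddCommGroup E] [InnerProductSpace ℝ E]

/-- A symmetric operator with spectrum in `[m, M]` satisfies `(R - m)(M - R) ≥ 0`. -/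
theorem norm_sq_apply_le_of_symmetric {R : E →ₗ[ℝ] E} {m M : ℝ} (hmM : m < M)
    (hs : ∀ x y, inner ℝ (R x) y = inner ℝ x (R y))
    (hm : ∀ x, m * ‖x‖ ^ 2 ≤ inner ℝ (R x) x) (hM : ∀ x, inner ℝ (R x) x ≤ M * ‖x‖ ^ 2) (x : E) :
    ‖R x‖ ^ 2 ≤ (m + M) * inner ℝ (R x) x - m * M * ‖x‖ ^ 2 := by
  set c := M - m with hc
  have hc0 : 0 < c := sub_pos.2 hmM
  set y := R x - m • x with hy
  -- With y = (R-m)x, positivity of R-m at x - c⁻¹y and R-m ≤ c at y give ‖y‖² ≤ c⟨y, x⟩, which is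
  -- the claim; no functional calculus is required.
  have h1 := hm (x - c⁻¹ • y)
  have h2 := hM y
  have e1 : inner ℝ (R (x - c⁻¹ • y)) (x - c⁻¹ • y) = inner ℝ (R x) x
      - 2 * c⁻¹ * inner ℝ (R x) y + c⁻¹ ^ 2 * inner ℝ (R y) y := by
    rw [map_sub, map_smul]
    simp only [inner_sub_left, inner_sub_right, real_inner_smul_left, real_inner_smul_right]
    rw [hs y x, real_inner_comm (R x) y]
    ring
  have e2 : ‖x - c⁻¹ • y‖ ^ 2 = ‖x‖ ^ 2 - 2 * c⁻¹ * inner ℝ x y + c⁻¹ ^ 2 * ‖y‖ ^ 2 := by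
    rw [norm_sub_sq_real, real_inner_smul_right, norm_smul, mul_pow, Real.norm_eq_abs, sq_abs]
    ring
  have e3 : inner ℝ (R x) y - m * inner ℝ x y = ‖y‖ ^ 2 := by
    rw [← real_inner_self_eq_norm_sq, ← real_inner_smul_left, ← inner_sub_left]
  have e4 : ‖y‖ ^ 2 = ‖R x‖ ^ 2 - 2 * m * inner ℝ (R x) x + m ^ 2 * ‖x‖ ^ 2 := by
    rw [hy, norm_sub_sq_real, real_inner_smul_right, norm_smul, mul_pow, Real.norm_eq_abs, sq_abs]
    ring
  rw [e1, e2] at h1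
  have h3 : c⁻¹ ^ 2 * inner ℝ (R y) y ≤ c⁻¹ ^ 2 * (M * ‖y‖ ^ 2) := by gcongr
  have h4 : c⁻¹ ^ 2 * (M - m) = c⁻¹ := by rw [← hc]; field_simp
  have h5 : c⁻¹ * ‖y‖ ^ 2 ≤ inner ℝ (R x) x - m * ‖x‖ ^ 2 := by
    have e5 : c⁻¹ ^ 2 * (M * ‖y‖ ^ 2) - c⁻¹ ^ 2 * (m * ‖y‖ ^ 2) = c⁻¹ * ‖y‖ ^ 2 := by
      linear_combination ‖y‖ ^ 2 * h4
    have e6 : c⁻¹ * inner ℝ (R x) y - c⁻¹ * (m * inner ℝ x y) = c⁻¹ * ‖y‖ ^ 2 := by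
      rw [← e3]; ring
    linarith
  have h6 : ‖y‖ ^ 2 ≤ c * (inner ℝ (R x) x - m * ‖x‖ ^ 2) := by
    rwa [inv_mul_le_iff₀ hc0] at h5
  rw [e4] at h6
  linarith

/-- Gradient-step contraction with step `s`. -/
theorem norm_sub_smul_le {x h : E} {m M s : ℝ} (hm0 : 0 < m) (hmM : m < M) (hs : 0 ≤ s)
    (hm : m * ‖x‖ ^ 2 ≤ inner ℝ h x) (hM : inner ℝ h x ≤ M * ‖x‖ ^ 2)
    (hh : ‖h‖ ^ 2 ≤ (m + M) * inner ℝ h x - m * M * ‖x‖ ^ 2) :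
    ‖x - s • h‖ ≤ Real.sqrt (1 + M ^ 2 * s ^ 2 - 2 * m * s) * ‖x‖ := by
  rw [← Real.sqrt_sq (norm_nonneg x), ← Real.sqrt_mul' _ (sq_nonneg _)]
  refine Real.le_sqrt_of_sq_le ?_
  rw [norm_sub_sq_real, real_inner_smul_right, norm_smul, mul_pow, Real.norm_eq_abs, sq_abs,
    real_inner_comm]
  have h1 : ‖h‖ ^ 2 ≤ M ^ 2 * ‖x‖ ^ 2 := by nlinarith
  have h2 := mul_le_mul_of_nonneg_left h1 (sq_nonneg s)
  have h3 := mul_le_mul_of_nonneg_left hm hs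
  linarith

/-- Gradient-step contraction with the optimal step `2 / (m + M)`. -/
theorem norm_sub_optimal_smul_le {x h : E} {m M : ℝ} (hm0 : 0 < m) (hmM : m < M)
    (hh : ‖h‖ ^ 2 ≤ (m + M) * inner ℝ h x - m * M * ‖x‖ ^ 2) :
    ‖x - (2 / (m + M)) • h‖ ≤ (M - m) / (m + M) * ‖x‖ := by
  have hT : 0 < m + M := by linarith
  have hd : 0 ≤ (M - m) / (m + M) := div_nonneg (by linarith) hT.le
  refine (abs_le_of_sq_le_sq' ?_ (mul_nonneg hd (norm_nonneg x))).2
  rw [norm_sub_sq_real, real_inner_smul_right, norm_smul, mul_pow, Real.norm_eq_abs, sq_abs,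
    real_inner_comm, mul_pow]
  have h2 := mul_le_mul_of_nonneg_left hh (sq_nonneg (2 / (m + M)))
  have e : (2 / (m + M)) ^ 2 * ((m + M) * inner ℝ h x - m * M * ‖x‖ ^ 2) =
      2 * (2 / (m + M) * inner ℝ h x) + ((M - m) / (m + M)) ^ 2 * ‖x‖ ^ 2 - ‖x‖ ^ 2 := by
    field_simp
    ring
  linarith

variable (V : Submodule ℝ E) [V.HasOrthogonalProjection]

theorem norm_starProjection_le (x : E) : ‖V.starProjection x‖ ≤ ‖x‖ := by
  have := ContinuousLinearMap.le_of_opNorm_le _ (V.starProjection_norm_le) x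
  simpa using this

/-- Write Px = sPh + P(x - sh): the head condition bounds Ph from below and q bounds the remainder.
The scale s is free and belongs to the analysis only; it is not the step size of the algorithm. -/
theorem le_norm_starProjection {x h e : E} {cH m s q ν η₀ : ℝ} (hs : 0 ≤ s) (hcH : cH ≤ 1)
    (hν : 0 ≤ ν)
    (hhead : cH * (m * ‖x‖ - ν) ≤ ‖V.starProjection (h + e)‖) (he : ‖V.starProjection e‖ ≤ ν)
    (hq : ‖x - s • h‖ ≤ q * ‖x‖) (hη : η₀ ≤ cH * s * m - q) :
    η₀ * ‖x‖ - 2 * s * ν ≤ ‖V.starProjection x‖ := by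
  have h1 : s * ‖V.starProjection h‖ ≤ ‖V.starProjection x‖ + q * ‖x‖ := by
    have e1 : s * ‖V.starProjection h‖ = ‖V.starProjection (x - (x - s • h))‖ := by
      rw [sub_sub_cancel, map_smul, norm_smul, Real.norm_of_nonneg hs]
    rw [e1, map_sub]
    exact (norm_sub_le _ _).trans (add_le_add le_rfl ((norm_starProjection_le V _).trans hq))
  have h2 : ‖V.starProjection (h + e)‖ ≤ ‖V.starProjection h‖ + ν := by
    rw [map_add]
    exact (norm_add_le _ _).trans (by linarith)
  have h3 := mul_le_mul_of_nonneg_left (hhead.trans h2) hs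
  have h4 := mul_le_mul_of_nonneg_right hη (norm_nonneg x)
  have h5 : s * cH * ν ≤ s * 1 * ν := by gcongr
  linarith

theorem norm_sub_starProjection_le {x : E} {η₀ ν : ℝ} (h0 : 0 < η₀) (h1 : η₀ < 1) (hν : 0 ≤ ν)
    (h : η₀ * ‖x‖ - ν ≤ ‖V.starProjection x‖) :
    ‖x - V.starProjection x‖ ≤
      Real.sqrt (1 - η₀ ^ 2) * ‖x‖ + η₀ / Real.sqrt (1 - η₀ ^ 2) * ν := by
  have hw2 : 0 < 1 - η₀ ^ 2 := by nlinarith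
  have hw := Real.sqrt_pos.2 hw2
  have hsq := Real.sq_sqrt hw2.le
  set w := Real.sqrt (1 - η₀ ^ 2) with hwdef
  have hpy : ‖x - V.starProjection x‖ ^ 2 = ‖x‖ ^ 2 - ‖V.starProjection x‖ ^ 2 := by
    rw [norm_sub_sq_real]
    have : inner ℝ x (V.starProjection x) = ‖V.starProjection x‖ ^ 2 := by
      rw [← real_inner_self_eq_norm_sq, Submodule.inner_starProjection_left_eq_right,
        Submodule.starProjection_eq_self_iff.2 (Submodule.starProjection_apply_mem _ _)]
    rw [this]
    ring
  have hx := norm_nonneg x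
  refine (abs_le_of_sq_le_sq' ?_ (by positivity)).2
  have e1 : (w * ‖x‖ + η₀ / w * ν) ^ 2 =
      w ^ 2 * ‖x‖ ^ 2 + 2 * η₀ * ‖x‖ * ν + η₀ ^ 2 / w ^ 2 * ν ^ 2 := by
    field_simp
    ring
  rw [e1, hpy, hsq]
  -- When ν exceeds η₀‖x‖ the hypothesis is empty, but then the cross term 2η₀‖x‖ν alone lifts the
  -- right side above ‖x‖².
  rcases le_or_gt ν (η₀ * ‖x‖) with hle | hlt
  · have h2 : (η₀ * ‖x‖ - ν) ^ 2 ≤ ‖V.starProjection x‖ ^ 2 :=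
      pow_le_pow_left₀ (by linarith) h 2
    have h3 : 0 ≤ η₀ ^ 2 / (1 - η₀ ^ 2) * ν ^ 2 := by positivity
    nlinarith
  · have h2 : η₀ * (η₀ * ‖x‖) ≤ η₀ * ν := by gcongr
    have h3 : 0 ≤ η₀ ^ 2 / (1 - η₀ ^ 2) * ν ^ 2 := by positivity
    have h4 := mul_le_mul_of_nonneg_left h2 hx
    nlinarith [sq_nonneg ‖V.starProjection x‖, sq_nonneg (η₀ * ‖x‖)]

/-- Splits the step as (x - Px) + P(x - ηh) - ηPe: what the head misses, the contraction, the noise.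
-/
theorem norm_sub_smul_starProjection_le {x h e : E} {η : ℝ} (hη : 0 ≤ η) :
    ‖x - η • V.starProjection (h + e)‖ ≤
      ‖x - V.starProjection x‖ + ‖x - η • h‖ + η * ‖V.starProjection e‖ := by
  have e1 : x - η • V.starProjection (h + e) = (x - V.starProjection x)
      + V.starProjection (x - η • h) - η • V.starProjection e := by
    rw [map_sub, map_smul, map_add, smul_add]
    abel
  rw [e1]
  refine (norm_sub_le _ _).trans (add_le_add ((norm_add_le _ _).trans
    (add_le_add le_rfl (norm_starProjection_le V _))) ?_)
  rw [norm_smul, Real.norm_of_nonneg hη]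

end Hilbert

/-! ### Scalar parameters -/

/-- Positivity forces 1 + M² - 2m < m² < M². With m = 1/hi² this reads hi² < 2, an absolute bound on
the scale of the problem. -/
theorem half_lt_of_eta0_pos {cH m M : ℝ} (hcH : cH < 1) (hm : 0 < m) (hmM : m < M)
    (h0 : 0 < eta0 cH m M) : 1 / 2 < m := by
  have h1 : Real.sqrt (1 + M ^ 2 - 2 * m) < m := by
    unfold eta0 at h0
    nlinarith
  rw [Real.sqrt_lt' hm] at h1
  nlinarith

theorem eta0_lt_one {cH m M : ℝ} (hcH : cH < 1) (hm : 0 < m) (hmM : m < M) :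
    eta0 cH m M < 1 := by
  have h1 : m - 1 ≤ Real.sqrt (1 + M ^ 2 - 2 * m) :=
    (le_abs_self _).trans (Real.abs_le_sqrt (by nlinarith))
  unfold eta0
  nlinarith

/-- For `m > 1` the optimal step size gives at least the head constant `η₀`. -/
theorem eta0_le_of_one_le {cH m M : ℝ} (hcH : cH < 1) (hm : 1 ≤ m) (hmM : m < M) :
    eta0 cH m M ≤ cH * (2 / (m + M)) * m - (M - m) / (m + M) := by
  have hT : 0 < m + M := by linarith
  -- Let z be the contraction factor (M-m)/(m+M). Passing from scale 1 to 2/(m+M) lowers the term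
  -- c_H s m by at most m - 1 + z, and the new remainder is z, so the old square root must dominate
  -- m - 1 + 2z.
  have key : m - 1 + 2 * ((M - m) / (m + M)) ≤ Real.sqrt (1 + M ^ 2 - 2 * m) := by
    refine Real.le_sqrt_of_sq_le ?_
    have h1 : (M - m) / (m + M) * (m + M) = M - m := div_mul_cancel₀ _ hT.ne'
    set z := (M - m) / (m + M) with hz
    have hz0 : 0 ≤ z := div_nonneg (by linarith) hT.le
    have hz1 : z ≤ 1 := by rw [hz, div_le_one hT]; linarith
    have h2 : 4 * (m - 1) + 4 * z ≤ (m + M) ^ 2 := by nlinarith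
    have h3 := mul_le_mul_of_nonneg_left h2 hz0
    have h4 : z * (m + M) ^ 2 = M ^ 2 - m ^ 2 := by linear_combination (m + M) * h1
    nlinarith
  have h5 : cH * m - cH * (2 / (m + M)) * m ≤ m - 1 + (M - m) / (m + M) := by
    have h6 : 0 ≤ m - 2 / (m + M) * m := by
      have : 2 / (m + M) ≤ 1 := by rw [div_le_one hT]; linarith
      nlinarith
    have h7 : m - 2 / (m + M) * m = m - 1 + (M - m) / (m + M) := by
      field_simp
      ring
    nlinarith
  unfold eta0
  linarith

/-- This is ρ₁ < 1 divided by 1 + c_T. Together with ρ₀ < 1/2 it yields the remaining facts on η, m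
and M. -/
theorem sqrt_one_sub_sq_lt_of_rho1_lt {cT cH m M η : ℝ} (hcT : 1 < cT)
    (h : rho1 cT cH m M η < 1) :
    Real.sqrt (1 + M ^ 2 * η ^ 2 - 2 * m * η) < rho0 cT cH m M := by
  unfold rho1 at h
  rw [← lt_div_iff₀ (by linarith)] at h
  unfold rho0
  linarith

theorem rho0_pos {cT cH m M η : ℝ} (hcT : 1 < cT) (h : rho1 cT cH m M η < 1) :
    0 < rho0 cT cH m M :=
  (Real.sqrt_nonneg _).trans_lt (sqrt_one_sub_sq_lt_of_rho1_lt hcT h)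

theorem rho0_lt_half {cT cH m M : ℝ} (hcT : 1 < cT) : rho0 cT cH m M < 1 / 2 := by
  have h1 : 1 / (1 + cT) < 1 / 2 := one_div_lt_one_div_of_lt (by norm_num) (by linarith)
  unfold rho0
  linarith [Real.sqrt_nonneg (1 - eta0 cH m M ^ 2)]

theorem quadratic_lt_rho0_sq {cT cH m M η : ℝ} (hcT : 1 < cT) (h : rho1 cT cH m M η < 1) :
    1 + M ^ 2 * η ^ 2 - 2 * m * η < rho0 cT cH m M ^ 2 :=
  (Real.sqrt_lt' (rho0_pos hcT h)).1 (sqrt_one_sub_sq_lt_of_rho1_lt hcT h)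

theorem step_pos {cT cH m M η : ℝ} (hcT : 1 < cT) (hm : 0 < m) (h : rho1 cT cH m M η < 1) :
    0 < η := by
  have h1 := quadratic_lt_rho0_sq hcT h
  have h2 := rho0_pos hcT h
  have h3 := rho0_lt_half (cH := cH) (m := m) (M := M) hcT
  by_contra! hη
  nlinarith [sq_nonneg (M * η), mul_nonneg hm.le (neg_nonneg.2 hη)]

theorem sq_mul_step_le {cT cH m M η : ℝ} (hcT : 1 < cT) (hm : 0 < m)
    (h : rho1 cT cH m M η < 1) : M ^ 2 * η ≤ 2 * m := by
  have h1 := quadratic_lt_rho0_sq hcT h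
  have h2 := rho0_pos hcT h
  have h3 := rho0_lt_half (cH := cH) (m := m) (M := M) hcT
  have hη := step_pos hcT hm h
  refine le_of_mul_le_mul_right ?_ hη
  nlinarith

/-- The quadratic 1 + M²η² - 2mη has minimum 1 - m²/M² over η, and it lies below ρ₀². -/
theorem sq_div_sq_le {cT cH m M η : ℝ} (hcT : 1 < cT) (hm : 0 < m) (hM : 0 < M)
    (h : rho1 cT cH m M η < 1) : M ^ 2 / m ^ 2 ≤ 1 / (1 - rho0 cT cH m M ^ 2) := by
  have h1 := quadratic_lt_rho0_sq hcT h
  have h2 := rho0_pos hcT h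
  have h3 := rho0_lt_half (cH := cH) (m := m) (M := M) hcT
  rw [div_le_div_iff₀ (by positivity) (by nlinarith)]
  have h4 : M ^ 2 * (1 + M ^ 2 * η ^ 2 - 2 * m * η) ≤ M ^ 2 * rho0 cT cH m M ^ 2 := by gcongr
  nlinarith [sq_nonneg (M ^ 2 * η - m)]

theorem rho1_nonneg {cT cH m M η : ℝ} (hcT : 1 < cT) : 0 ≤ rho1 cT cH m M η :=
  mul_nonneg (add_nonneg (Real.sqrt_nonneg _) (Real.sqrt_nonneg _)) (by linarith)

theorem one_le_rho2 {cT cH m M : ℝ} (hcT : 1 < cT) (h : 0 < eta0 cH m M) :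
    1 ≤ rho2 cT cH m M := by
  have : 0 ≤ eta0 cH m M / Real.sqrt (1 - eta0 cH m M ^ 2) :=
    div_nonneg h.le (Real.sqrt_nonneg _)
  unfold rho2
  nlinarith

theorem rank_add_le (A B : Mat p) : (A + B).rank ≤ A.rank + B.rank := by
  rw [Matrix.rank, Matrix.rank, Matrix.rank, Matrix.mulVecLin_add]
  refine (Submodule.finrank_mono (LinearMap.range_add_le _ _)).trans ?_
  exact Submodule.finrank_add_le_finrank_add_finrank _ _

/-! ### One step of the algorithm -/

/-- The map `X ↦ P X Q`, on matrices read as Euclidean vectors. -/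
def sandwich (P Q : Mat p) :
    EuclideanSpace ℝ (Fin p × Fin p) →ₗ[ℝ] EuclideanSpace ℝ (Fin p × Fin p) :=
  (toEuc (p := p)).toLinearMap ∘ₗ (LinearMap.mulLeft ℝ P ∘ₗ LinearMap.mulRight ℝ Q) ∘ₗ
    (toEuc (p := p)).symm.toLinearMap

theorem sandwich_toEuc (P Q X : Mat p) : sandwich P Q (toEuc X) = toEuc (P * X * Q) := by
  simp [sandwich, mul_assoc]

theorem sandwich_bounds {lo hi : ℝ} (hlo : 0 < lo) (hlohi : lo < hi) {A B : Mat p}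
    (hA : Between lo hi A) (hB : Between lo hi B) (x : EuclideanSpace ℝ (Fin p × Fin p)) :
    1 / hi ^ 2 * ‖x‖ ^ 2 ≤ inner ℝ (sandwich A⁻¹ B⁻¹ x) x ∧
      inner ℝ (sandwich A⁻¹ B⁻¹ x) x ≤ 1 / lo ^ 2 * ‖x‖ ^ 2 := by
  obtain ⟨X, rfl⟩ := (toEuc (p := p)).surjective x
  have hhi := hlo.trans hlohi
  have := frobInner_mul_mul_bounds (inv_nonneg.2 hhi.le) (inv_anti₀ hlo hlohi.le)
    (hA.inv hlo hhi) (hB.inv hlo hhi) X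
  rw [sandwich_toEuc, inner_toEuc, norm_toEuc]
  simpa using this

theorem norm_sq_sandwich_le {lo hi : ℝ} (hlo : 0 < lo) (hlohi : lo < hi) {A B : Mat p}
    (hA : Between lo hi A) (hB : Between lo hi B) (x : EuclideanSpace ℝ (Fin p × Fin p)) :
    ‖sandwich A⁻¹ B⁻¹ x‖ ^ 2 ≤ (1 / hi ^ 2 + 1 / lo ^ 2) * inner ℝ (sandwich A⁻¹ B⁻¹ x) x
      - 1 / hi ^ 2 * (1 / lo ^ 2) * ‖x‖ ^ 2 := by
  refine norm_sq_apply_le_of_symmetric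
    (one_div_lt_one_div_of_lt (by positivity) (by gcongr)) (fun x y => ?_)
    (fun x => (sandwich_bounds hlo hlohi hA hB x).1)
    (fun x => (sandwich_bounds hlo hlohi hA hB x).2) x
  obtain ⟨X, rfl⟩ := (toEuc (p := p)).surjective x
  obtain ⟨Y, rfl⟩ := (toEuc (p := p)).surjective y
  rw [sandwich_toEuc, sandwich_toEuc, inner_toEuc, inner_toEuc]
  exact frobInner_mul_mul_comm
    (by simpa [Matrix.IsSymm] using (hA.posDef hlo).inv.1)
    (by simpa [Matrix.IsSymm] using (hB.posDef hlo).inv.1) X Y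

/-- A step size for the analysis of the head projection whose noise amplification is
controlled by `lo`. -/
theorem exists_head_scale {cH lo hi m M : ℝ} (hcH1 : cH < 1) (hlo : 0 < lo)
    (hlohi : lo < hi) (h34 : 3 / 4 * hi ^ 2 ≤ lo ^ 2) (hm : m = 1 / hi ^ 2) (hM : M = 1 / lo ^ 2) :
    ∃ s q : ℝ, 0 ≤ s ∧ 2 * s ≤ 4 * lo ∧ eta0 cH m M ≤ cH * s * m - q ∧
      ∀ x h : EuclideanSpace ℝ (Fin p × Fin p), m * ‖x‖ ^ 2 ≤ inner ℝ h x →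
        inner ℝ h x ≤ M * ‖x‖ ^ 2 →
        ‖h‖ ^ 2 ≤ (m + M) * inner ℝ h x - m * M * ‖x‖ ^ 2 → ‖x - s • h‖ ≤ q * ‖x‖ := by
  have hhi : 0 < hi := hlo.trans hlohi
  have hm0 : 0 < m := by rw [hm]; positivity
  have hmM : m < M := by
    rw [hm, hM]
    exact one_div_lt_one_div_of_lt (by positivity) (by gcongr)
  have hmhi : m * hi ^ 2 = 1 := by rw [hm]; field_simp
  -- If m ≤ 1 then hi ≥ 1, so lo ≥ √3/2 and s = 1 satisfies 2s ≤ 4 lo. If m > 1 then lo may be tiny,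
  -- and s = 2/(m+M) ≤ hi² ≤ 2 lo² ≤ 2 lo scales correctly.
  rcases le_or_gt m 1 with h1 | h1
  · refine ⟨1, Real.sqrt (1 + M ^ 2 - 2 * m), zero_le_one, ?_, ?_, fun x h hx1 hx2 hx3 => ?_⟩
    · have : 1 ≤ hi ^ 2 := by nlinarith [sq_nonneg hi]
      nlinarith
    · simp [eta0]
    · simpa using norm_sub_smul_le hm0 hmM zero_le_one hx1 hx2 hx3
  · refine ⟨2 / (m + M), (M - m) / (m + M), div_nonneg zero_le_two (by linarith), ?_, eta0_le_of_one_le hcH1 h1.le hmM,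
      fun x h _ _ hx3 => norm_sub_optimal_smul_le hm0 hmM hx3⟩
    have hhi1 : hi < 1 := by
      by_contra! hc
      have : 1 ≤ hi ^ 2 := one_le_pow₀ hc
      nlinarith
    have h2 : 2 / (m + M) ≤ hi ^ 2 := by
      rw [div_le_iff₀ (by linarith)]
      have : hi ^ 2 * m ≤ hi ^ 2 * M := by gcongr
      nlinarith
    have h3 : hi ^ 2 ≤ 2 * lo ^ 2 := by nlinarith
    have h4 : lo ^ 2 ≤ lo := by nlinarith
    linarith

/-- From M²η ≤ 2m ≤ 2M one gets η ≤ 2 lo², and m > 1/2 gives lo < 2. A bound linear in lo is what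
the factor lo⁻¹ in the noise can cancel. -/
theorem step_le_of_rho1_lt {cT cH lo hi m M η : ℝ} (hcT : 1 < cT) (hcH1 : cH < 1) (hlo : 0 < lo)
    (hlohi : lo < hi) (hm : m = 1 / hi ^ 2) (hM : M = 1 / lo ^ 2)
    (hη₀ : 0 < eta0 cH m M) (hρ₁ : rho1 cT cH m M η < 1) : η ≤ 4 * lo := by
  have hhi : 0 < hi := hlo.trans hlohi
  have hm0 : 0 < m := by rw [hm]; positivity
  have hmM : m < M := by
    rw [hm, hM]
    exact one_div_lt_one_div_of_lt (by positivity) (by gcongr)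
  have h1 := half_lt_of_eta0_pos hcH1 hm0 hmM hη₀
  have h2 := sq_mul_step_le hcT hm0 hρ₁
  have hM0 := hm0.trans hmM
  have hMlo : M * lo ^ 2 = 1 := by rw [hM]; field_simp
  have h3 : η ≤ 2 * lo ^ 2 := by
    refine le_of_mul_le_mul_left ?_ (sq_pos_of_pos hM0)
    calc M ^ 2 * η ≤ 2 * m := h2
      _ ≤ 2 * M := by linarith
      _ = M ^ 2 * (2 * lo ^ 2) := by linear_combination (-2 * M) * hMlo
  have h4 : lo < 2 := by
    by_contra! hc
    nlinarith
  nlinarith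

/-- Contraction of the distance to the low-rank component in one step of the algorithm. -/
theorem frobNorm_step_le {S C Lstar L : Mat p} {r : ℕ} {cT cH lo hi m M η : ℝ} (hcT : 1 < cT)
    (hcH0 : 0 < cH) (hcH1 : cH < 1) (hlo : 0 < lo) (hlohi : lo < hi)
    (h34 : 3 / 4 * hi ^ 2 ≤ lo ^ 2) (hm : m = 1 / hi ^ 2) (hM : M = 1 / lo ^ 2)
    (hη₀ : 0 < eta0 cH m M) (hρ₁ : rho1 cT cH m M η < 1)
    (hA : Between lo hi (S + Lstar)) (hB : Between lo hi (S + L))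
    (hLstar : Lstar.rank ≤ r) (hL : L.rank ≤ r) {V W : Submodule ℝ (Mat p)}
    (hV : IsHead cH (2 * r) (gradObj S C L) V)
    (hW : IsTail cT r (L - η • proj V (gradObj S C L)) W) :
    frobNorm (proj W (L - η • proj V (gradObj S C L)) - Lstar) ≤
      rho1 cT cH m M η * frobNorm (L - Lstar) + rho2 cT cH m M *
        (4 * lo * (Real.sqrt (2 * r) * specNorm (gradObj S C Lstar))) := by
  have hhi : 0 < hi := hlo.trans hlohi
  have hm0 : 0 < m := by rw [hm]; positivity
  have hmM : m < M := by
    rw [hm, hM]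
    exact one_div_lt_one_div_of_lt (by positivity) (by gcongr)
  have hη₁ := eta0_lt_one hcH1 hm0 hmM
  have hηpos := step_pos hcT hm0 hρ₁
  have hηle := step_le_of_rho1_lt hcT hcH1 hlo hlohi hm hM hη₀ hρ₁
  obtain ⟨s, q, hs0, hslo, hsη, hsq⟩ :=
    exists_head_scale (p := p) hcH1 hlo hlohi h34 hm hM
  set G := gradObj S C Lstar with hG
  set x := toEuc (L - Lstar) with hx
  set h := sandwich (S + Lstar)⁻¹ (S + L)⁻¹ x with hh
  set e := toEuc G with he
  set ν := Real.sqrt (2 * r) * specNorm G with hν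
  have hν0 : 0 ≤ ν := mul_nonneg (Real.sqrt_nonneg _) (specNorm_nonneg _)
  have hg : toEuc (gradObj S C L) = h + e := by
    have h1 := inv_sub_inv (hA.posDef hlo) (hB.posDef hlo)
    rw [hh, hx, sandwich_toEuc, he, ← map_add]
    rw [add_sub_add_left_eq_sub] at h1
    rw [← h1, hG, gradObj, gradObj]
    congr 1
    abel
  have hx1 := (sandwich_bounds hlo hlohi hA hB x).1
  have hx2 := (sandwich_bounds hlo hlohi hA hB x).2
  have hx3 := norm_sq_sandwich_le hlo hlohi hA hB x
  rw [← hm] at hx1 hx3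
  rw [← hM] at hx2 hx3
  have hrank : (L - Lstar).rank ≤ 2 * r := by
    have := rank_add_le L (-Lstar)
    have h2 : (-Lstar).rank ≤ Lstar.rank := by
      simpa using rank_smul_le (-1) Lstar
    rw [sub_eq_add_neg]
    omega
  set V' := V.map (toEuc (p := p)).toLinearMap
  have hproj (A : Mat p) : toEuc (proj V A) = V'.starProjection (toEuc A) := toEuc_proj V A
  have hnoise {Z : Mat p} (hZ : Z.rank ≤ 2 * r) : |inner ℝ e (toEuc Z)| ≤ ν * ‖toEuc Z‖ := by
    have := abs_frobInner_le_of_rank_le G hZ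
    rw [he, inner_toEuc, norm_toEuc, hν]
    simpa using this
  -- L - L* has rank at most 2r, so testing the gradient against it bounds the norm of its best
  -- rank-2r approximation from below.
  have hhead : cH * (m * ‖x‖ - ν) ≤ ‖V'.starProjection (h + e)‖ := by
    obtain ⟨D, hD⟩ := exists_isBestApprox (2 * r) (gradObj S C L)
    have h1 := hV.2 D hD
    rw [← norm_toEuc (proj _ _), hproj, hg] at h1
    refine le_trans (mul_le_mul_of_nonneg_left ?_ hcH0.le) h1
    have h2 := hD.frobInner_le hrank
    rw [← inner_toEuc, hg, ← norm_toEuc (L - Lstar), ← hx, inner_add_left] at h2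
    have h3 := (abs_le.1 (hnoise hrank)).1
    rw [← hx] at h3
    rcases (norm_nonneg x).eq_or_lt with h0 | h0
    · rw [← h0]
      linarith [frobNorm_nonneg D]
    · refine le_of_mul_le_mul_right ?_ h0
      linarith [sq ‖x‖]
  -- Elements of V have rank at most 2r, so the low-rank noise bound applies to Pe itself, and ⟨e,
  -- Pe⟩ = ‖Pe‖².
  have hPe : ‖V'.starProjection e‖ ≤ ν := by
    have h1 := (abs_le.1 (hnoise (rank_le_of_mem_lowRankSubspaces hV.1 (proj_mem V G)))).2
    rw [hproj, ← he] at h1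
    have h2 : inner ℝ e (V'.starProjection e) = ‖V'.starProjection e‖ ^ 2 := by
      rw [← real_inner_self_eq_norm_sq, Submodule.inner_starProjection_left_eq_right,
        Submodule.starProjection_eq_self_iff.2 (Submodule.starProjection_apply_mem _ _)]
    rw [h2, sq] at h1
    rcases (norm_nonneg (V'.starProjection e)).eq_or_lt with h0 | h0
    · rw [← h0]
      exact hν0
    · exact le_of_mul_le_mul_right h1 h0
  have hPx := le_norm_starProjection V' hs0 hcH1.le hν0 hhead hPe (hsq x h hx1 hx2 hx3) hsη
  have hIP := norm_sub_starProjection_le V' hη₀ hη₁ (by positivity) hPx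
  have hstep := norm_sub_smul_le hm0 hmM hηpos.le hx1 hx2 hx3
  have hsum := norm_sub_smul_starProjection_le V' (x := x) (h := h) (e := e) hηpos.le
  set b := L - η • proj V (gradObj S C L) with hb
  have hbL : toEuc (b - Lstar) = x - η • V'.starProjection (h + e) := by
    rw [hb, ← hg, ← hproj, hx, ← map_smul, ← map_sub]
    congr 1
    abel
  -- L* has rank at most r and so competes with the best rank-r approximation of b.
  have htail : frobNorm (proj W b - Lstar) ≤ (1 + cT) * frobNorm (b - Lstar) := by
    obtain ⟨D, hD⟩ := exists_isBestApprox r b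
    have h1 := hW.2 D hD
    have h2 := mul_le_mul_of_nonneg_left (hD.2 Lstar hLstar) (by linarith : 0 ≤ cT)
    have h3 : frobNorm (proj W b - Lstar) ≤ frobNorm (b - proj W b) + frobNorm (b - Lstar) := by
      simp only [← norm_toEuc, map_sub]
      rw [← norm_sub_rev (toEuc (proj W b)) (toEuc b)]
      exact norm_sub_le_norm_sub_add_norm_sub _ _ _
    linarith
  refine htail.trans ?_
  rw [← norm_toEuc (b - Lstar), hbL, ← norm_toEuc (L - Lstar), ← hx]
  have hκ : 0 ≤ eta0 cH m M / Real.sqrt (1 - eta0 cH m M ^ 2) :=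
    div_nonneg hη₀.le (Real.sqrt_nonneg _)
  have h5 : eta0 cH m M / Real.sqrt (1 - eta0 cH m M ^ 2) * (2 * s * ν) ≤
      eta0 cH m M / Real.sqrt (1 - eta0 cH m M ^ 2) * (4 * lo * ν) := by gcongr
  have h6 : η * ‖V'.starProjection e‖ ≤ 4 * lo * ν := by gcongr
  have h7 : ‖x - η • V'.starProjection (h + e)‖ ≤
      (Real.sqrt (1 + M ^ 2 * η ^ 2 - 2 * m * η) + Real.sqrt (1 - eta0 cH m M ^ 2)) * ‖x‖
        + (eta0 cH m M / Real.sqrt (1 - eta0 cH m M ^ 2) + 1) * (4 * lo * ν) := by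
    linarith
  have h8 := mul_le_mul_of_nonneg_left h7 (by linarith : 0 ≤ 1 + cT)
  refine h8.trans (le_of_eq ?_)
  unfold rho1 rho2
  ring

/-! ### Invariance of the spectral box along a run. -/

theorem IsAPLVMRun.rank_le {S C : Mat p} {r : ℕ} {η cT cH : ℝ} {L : ℕ → Mat p}
    (h : IsAPLVMRun S C r η cT cH L) (t : ℕ) : (L t).rank ≤ r := by
  cases t with
  | zero => rw [h.1]; simp
  | succ t =>
    obtain ⟨-, V, W, -, hW, hL⟩ := h.2 t
    rw [hL]
    exact rank_le_of_mem_lowRankSubspaces hW.1 (proj_mem W _)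

/-- Matrices close to the low-rank component stay in the spectral box. -/
theorem mem_specBox_of_frobNorm_le {S Lstar L : Mat p} (hS : S.IsSymm)
    (hLstar : Lstar.PosSemidef) (hL : L.IsSymm) {a hi d : ℝ}
    (hd : frobNorm (L - Lstar) ≤ d) (hhi : lamMax S + specNorm Lstar + d ≤ hi)
    (ha : d ≤ a ∨ -a ≤ lamMin L) : L ∈ specBox S (lamMin S - a) hi := by
  have hLs : Lstar.IsSymm := by simpa [Matrix.IsSymm] using hLstar.1
  have hsub : specNorm (L - Lstar) ≤ d := (specNorm_le_frobNorm _).trans hd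
  refine ⟨hL, ?_, ?_⟩
  · have h1 : (L + a • (1 : Mat p)).PosSemidef := by
      rcases ha with ha | ha
      · have := (posSemidef_add_specNorm (hL.sub hLs) (hsub.trans ha)).add hLstar
        convert this using 1
        module
      · have := (posSemidef_sub_lamMin hL).add
          (Matrix.PosSemidef.one.smul (by linarith : 0 ≤ lamMin L + a))
        convert this using 1
        module
    convert (posSemidef_sub_lamMin hS).add h1 using 1
    module
  · have h1 := (posSemidef_lamMax_sub hS).add ((posSemidef_specNorm_sub hLs le_rfl).add
      (posSemidef_specNorm_sub (hL.sub hLs) hsub))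
    have h2 := h1.add (Matrix.PosSemidef.one.smul
      (by linarith : 0 ≤ hi - (lamMax S + specNorm Lstar + d)))
    convert h2 using 1
    module

/-- If the gradient at the low-rank component is small, the iterates do not leave the
spectral box. -/
theorem IsAPLVMRun.mem_specBox {S C Lstar : Mat p} {r : ℕ} {cT cH a hi m M η ε : ℝ}
    {L : ℕ → Mat p} (hrun : IsAPLVMRun S C r η cT cH L) (hS : S.IsSymm)
    (hLstar : Lstar.PosSemidef) (hrank : Lstar.rank ≤ r) (hcT : 1 < cT)
    (hcH0 : 0 < cH) (hcH1 : cH < 1) (hlo : 0 < lamMin S - a) (hlohi : lamMin S - a < hi)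
    (h34 : 3 / 4 * hi ^ 2 ≤ (lamMin S - a) ^ 2) (hm : m = 1 / hi ^ 2)
    (hM : M = 1 / (lamMin S - a) ^ 2)
    (hη₀ : 0 < eta0 cH m M) (hρ₁ : rho1 cT cH m M η < 1)
    (hbox : Lstar ∈ specBox S (lamMin S - a) hi)
    (hnoise : rho2 cT cH m M * (4 * (lamMin S - a) *
      (Real.sqrt (2 * r) * specNorm (gradObj S C Lstar))) ≤ (1 - rho1 cT cH m M η) * ε)
    (hε : 0 ≤ ε) (hhi : lamMax S + (1 + Real.sqrt r) * specNorm Lstar + ε ≤ hi) (T : ℕ)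
    (ha : (1 + Real.sqrt r) * specNorm Lstar + ε ≤ a ∨ ∀ t ≤ T, -a ≤ lamMin (L t)) :
    ∀ t ≤ T, L t ∈ specBox S (lamMin S - a) hi := by
  have hbox' (t : ℕ) (ht : t ≤ T)
      (hd : frobNorm (L t - Lstar) ≤ Real.sqrt r * specNorm Lstar + ε) :
      L t ∈ specBox S (lamMin S - a) hi := by
    refine mem_specBox_of_frobNorm_le hS hLstar (hrun.2 t).1 hd (by linarith) ?_
    refine ha.imp (fun h => ?_) (fun h => h t ht)
    linarith [specNorm_nonneg Lstar]
  -- The contraction at time t needs L^t in the box, which the distance bound at time t supplies.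
  -- The radius √r‖L*‖₂ + ε survives because d ↦ ρ₁ d + (1-ρ₁)ε fixes ε and contracts the excess.
  have hdist (t : ℕ) (ht : t ≤ T) :
      frobNorm (L t - Lstar) ≤ Real.sqrt r * specNorm Lstar + ε := by
    induction t with
    | zero =>
      have h1 := frobNorm_le_of_rank_le hrank
      rw [hrun.1, ← norm_toEuc, zero_sub, map_neg, norm_neg, norm_toEuc]
      linarith
    | succ t ih =>
      have ih' := ih (by omega)
      obtain ⟨-, V, W, hV, hW, hL⟩ := hrun.2 t
      have h1 := frobNorm_step_le hcT hcH0 hcH1 hlo hlohi h34 hm hM hη₀ hρ₁ hbox.2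
        (hbox' t (by omega) ih').2 hrank (hrun.rank_le t) hV hW
      rw [hL]
      have h2 := rho1_nonneg (cH := cH) (m := m) (M := M) (η := η) hcT
      have h3 := mul_le_mul_of_nonneg_left ih' h2
      have h4 : 0 ≤ Real.sqrt r * specNorm Lstar :=
        mul_nonneg (Real.sqrt_nonneg _) (specNorm_nonneg _)
      nlinarith
  exact fun t ht => hbox' t ht (hdist t ht)

/-! ### Nets of the sphere -/

/-- A 1/2-separated set of maximal cardinality is a 1/2-net. Doubled, it is 1-separated in the ball
of radius 2, which caps its size at 5^p. -/
theorem exists_sphere_net (p : ℕ) : ∃ N : Finset (EuclideanSpace ℝ (Fin p)),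
    N.card ≤ 5 ^ p ∧ (∀ y ∈ N, ‖y‖ = 1) ∧
      ∀ x : EuclideanSpace ℝ (Fin p), ‖x‖ = 1 → ∃ y ∈ N, ‖x - y‖ ≤ 1 / 2 := by
  classical
  let P : Finset (EuclideanSpace ℝ (Fin p)) → Prop := fun s =>
    (∀ c ∈ s, ‖c‖ = 1) ∧ ∀ c ∈ s, ∀ d ∈ s, c ≠ d → 1 / 2 ≤ ‖c - d‖
  have hcard (s) (hs : P s) : s.card ≤ 5 ^ p := by
    have h := Besicovitch.card_le_of_separated (s.image fun c => (2 : ℝ) • c)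
      (by
        intro c hc
        obtain ⟨d, hd, rfl⟩ := Finset.mem_image.1 hc
        rw [norm_smul, hs.1 d hd]
        norm_num)
      (by
        intro c hc d hd hne
        obtain ⟨c, hc', rfl⟩ := Finset.mem_image.1 hc
        obtain ⟨d, hd', rfl⟩ := Finset.mem_image.1 hd
        have := hs.2 c hc' d hd' (fun h => hne (by rw [h]))
        rw [← smul_sub, norm_smul, Real.norm_of_nonneg zero_le_two]
        linarith)
    rwa [Finset.card_image_of_injective _ (smul_right_injective _ two_ne_zero),
      finrank_euclideanSpace_fin] at h
  obtain ⟨s, hs, hsk⟩ := Nat.findGreatest_spec (P := fun k => ∃ s, P s ∧ s.card = k)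
    (n := 5 ^ p) (Nat.zero_le _) ⟨∅, by simp [P], rfl⟩
  refine ⟨s, hcard s hs, hs.1, fun x hx => ?_⟩
  by_contra! hfar
  have hxs : x ∉ s := fun h => by
    have := hfar x h
    norm_num at this
  have hP : P (insert x s) := by
    refine ⟨?_, ?_⟩
    · intro c hc
      rcases Finset.mem_insert.1 hc with rfl | hc
      · exact hx
      · exact hs.1 c hc
    · intro c hc d hd hne
      rcases Finset.mem_insert.1 hc with rfl | hc' <;>
        rcases Finset.mem_insert.1 hd with rfl | hd'
      · exact absurd rfl hne
      · exact (hfar d hd').le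
      · rw [norm_sub_rev]
        exact (hfar c hc').le
      · exact hs.2 c hc' d hd' hne
  have h1 := Nat.le_findGreatest (P := fun k => ∃ s, P s ∧ s.card = k) (hcard _ hP) ⟨_, hP, rfl⟩
  rw [Finset.card_insert_of_notMem hxs, ← hsk] at h1
  omega

/-- The forms at x and y differ by ⟨T(x-y), x+y⟩. At radius 1/2 the crude bound ‖x+y‖ ≤ 2 gives
nothing; the parallelogram law gives ‖x-y‖‖x+y‖ ≤ √15/4 < 31/32, whence the factor 32. -/
theorem norm_le_of_net {E : Type*} [NormedAddCommGroup E] [InnerProductSpace ℝ E]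
    {T : E →L[ℝ] E} (hT : ∀ x y, inner ℝ (T x) y = inner ℝ x (T y)) {N : Set E} {t : ℝ}
    (hN : ∀ y ∈ N, ‖y‖ = 1) (hnet : ∀ x : E, ‖x‖ = 1 → ∃ y ∈ N, ‖x - y‖ ≤ 1 / 2) (ht : 0 ≤ t)
    (h : ∀ y ∈ N, |inner ℝ (T y) y| ≤ t) : ‖T‖ ≤ 32 * t := by
  have hunit (x : E) (hx : ‖x‖ = 1) : |inner ℝ (T x) x| ≤ t + 31 / 32 * ‖T‖ := by
    obtain ⟨y, hy, hxy⟩ := hnet x hx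
    have e : inner ℝ (T x) x - inner ℝ (T y) y = inner ℝ (T (x - y)) (x + y) := by
      rw [map_sub, inner_add_right, inner_sub_left, inner_sub_left, hT x y, real_inner_comm (T y) x]
      ring
    have h1 : |inner ℝ (T (x - y)) (x + y)| ≤ ‖T‖ * (‖x - y‖ * ‖x + y‖) := by
      refine (abs_real_inner_le_norm _ _).trans ?_
      rw [← mul_assoc]
      gcongr
      exact T.le_opNorm _
    have hp := parallelogram_law_with_norm ℝ x y
    rw [hx, hN y hy] at hp
    have h2 : ‖x - y‖ * ‖x + y‖ ≤ 31 / 32 := by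
      refine (abs_le_of_sq_le_sq' ?_ (by norm_num)).2
      rw [mul_pow]
      have h3 : ‖x + y‖ ^ 2 = 4 - ‖x - y‖ ^ 2 := by linarith
      rw [h3]
      have h4 : ‖x - y‖ ^ 2 ≤ 1 / 4 := by nlinarith [norm_nonneg (x - y)]
      nlinarith [sq_nonneg ‖x - y‖]
    have h3 : ‖T‖ * (‖x - y‖ * ‖x + y‖) ≤ ‖T‖ * (31 / 32) := by gcongr
    have h4 := abs_sub_abs_le_abs_sub (inner ℝ (T x) x) (inner ℝ (T y) y)
    rw [e] at h4
    linarith [h y hy]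
  have hb : ‖T‖ ≤ t + 31 / 32 * ‖T‖ := by
    conv_lhs => rw [ContinuousLinearMap.norm_eq_iSup_rayleighQuotient T (fun x y => hT x y)]
    refine ciSup_le fun x => ?_
    rcases eq_or_ne x 0 with rfl | hx
    · simp only [ContinuousLinearMap.rayleighQuotient_apply_zero, abs_zero]
      positivity
    · have hx' : 0 < ‖x‖ := norm_pos_iff.2 hx
      have hu : ‖(‖x‖⁻¹ : ℝ) • x‖ = 1 := by
        rw [norm_smul, norm_inv, norm_norm, inv_mul_cancel₀ hx'.ne']
      have h1 := hunit _ hu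
      have h2 := ContinuousLinearMap.rayleigh_smul (𝕜 := ℝ) T x (c := ‖x‖⁻¹)
        (inv_ne_zero hx'.ne')
      rw [← h2]
      simpa [ContinuousLinearMap.rayleighQuotient, ContinuousLinearMap.reApplyInnerSelf_apply,
        hu] using h1
  linarith

/-! ### Chi-square concentration -/

theorem neg_log_one_sub_le {u : ℝ} (hu : |u| ≤ 1 / 2) : -Real.log (1 - u) ≤ u + 2 * u ^ 2 := by
  have h := Real.abs_log_sub_add_sum_range_le (x := u) (by linarith) 1
  simp only [Finset.sum_range_one, zero_add, pow_one, Nat.cast_zero, div_one] at h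
  have h2 : |u| ^ (1 + 1) / (1 - |u|) ≤ 2 * u ^ 2 := by
    rw [div_le_iff₀ (by linarith), show (1 + 1 : ℕ) = 2 from rfl, sq_abs]
    nlinarith [sq_nonneg u]
  linarith [(abs_le.1 h).1]

theorem integrable_exp_mul_sq_gaussianReal {l : ℝ} (hl : l < 1 / 2) :
    Integrable (fun x : ℝ => Real.exp (l * (x ^ 2 - 1))) (gaussianReal 0 1) := by
  rw [gaussianReal_of_var_ne_zero _ one_ne_zero,
    integrable_withDensity_iff_integrable_smul' (measurable_gaussianPDF _ _)
      (Filter.Eventually.of_forall fun x => gaussianPDF_lt_top)]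
  have h := (integrable_exp_neg_mul_sq (b := 1 / 2 - l) (by linarith)).const_mul
    ((Real.sqrt (2 * Real.pi))⁻¹ * Real.exp (-l))
  refine h.congr (Filter.Eventually.of_forall fun x => ?_)
  simp only [toReal_gaussianPDF, gaussianPDFReal, NNReal.coe_one, mul_one, sub_zero, smul_eq_mul]
  rw [mul_assoc, mul_assoc, ← Real.exp_add, ← Real.exp_add]
  congr 2
  ring

/-- The exact value is e^{-l}(1-2l)^{-1/2}; the quadratic bound for -log(1-2l) cancels the linear
term. -/
theorem mgf_sq_sub_one_le {l : ℝ} (hl : |l| ≤ 1 / 4) :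
    mgf (fun x : ℝ => x ^ 2 - 1) (gaussianReal 0 1) l ≤ Real.exp (4 * l ^ 2) := by
  obtain ⟨hl1, hl2⟩ := abs_le.1 hl
  have h1 : mgf (fun x : ℝ => x ^ 2 - 1) (gaussianReal 0 1) l =
      Real.exp (-l) * Real.sqrt (1 - 2 * l)⁻¹ := by
    rw [mgf, integral_gaussianReal_eq_integral_smul one_ne_zero]
    have e (x : ℝ) : gaussianPDFReal 0 1 x • Real.exp (l * (x ^ 2 - 1)) =
        (Real.sqrt (2 * Real.pi))⁻¹ * Real.exp (-l) * Real.exp (-(1 / 2 - l) * x ^ 2) := by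
      simp only [gaussianPDFReal, NNReal.coe_one, mul_one, sub_zero, smul_eq_mul]
      rw [mul_assoc, mul_assoc, ← Real.exp_add, ← Real.exp_add]
      congr 2
      ring
    simp_rw [e]
    rw [integral_const_mul, integral_gaussian, mul_comm _ (Real.exp (-l)), mul_assoc,
      ← Real.sqrt_inv, ← Real.sqrt_mul (by positivity)]
    congr 2
    have : (1 / 2 - l) ≠ 0 := by linarith
    have h3 : 1 - 2 * l ≠ 0 := by linarith
    have := Real.pi_ne_zero
    field_simp
  have hpos : 0 < 1 - 2 * l := by linarith
  have h2 := neg_log_one_sub_le (u := 2 * l) (by rw [abs_mul, abs_two]; linarith)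
  rw [h1, Real.sqrt_eq_rpow, Real.rpow_def_of_pos (inv_pos.2 hpos), Real.log_inv, ← Real.exp_add]
  refine Real.exp_le_exp.2 ?_
  nlinarith

section Chernoff

variable {Ω : Type*} [MeasurableSpace Ω] {μ : Measure Ω} [IsProbabilityMeasure μ]

theorem chiSquare_concentration {n : ℕ} {U : Fin n → Ω → ℝ} (hU : ∀ i, Measurable (U i))
    (hind : iIndepFun U μ) (hlaw : ∀ i, μ.map (U i) = gaussianReal 0 1) {t : ℝ} (ht0 : 0 ≤ t)
    (ht1 : t ≤ 1) :
    μ.real {ω | n * t ≤ |∑ i, (U i ω ^ 2 - 1)|} ≤ 2 * Real.exp (-(n * t ^ 2 / 16)) := by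
  let Y : Fin n → Ω → ℝ := fun i ω => U i ω ^ 2 - 1
  have hY (i) : Measurable (Y i) := ((hU i).pow_const 2).sub_const 1
  have hYind : iIndepFun Y μ :=
    hind.comp (fun _ x => x ^ 2 - 1) fun _ => (measurable_id.pow_const 2).sub_const 1
  have hmeas (l : ℝ) : AEStronglyMeasurable (fun x : ℝ => Real.exp (l * (x ^ 2 - 1)))
      (gaussianReal 0 1) := by
    have : Continuous fun x : ℝ => Real.exp (l * (x ^ 2 - 1)) := by fun_prop
    exact this.aestronglyMeasurable
  have hint (l : ℝ) (hl : |l| ≤ 1 / 4) (i) : Integrable (fun ω => Real.exp (l * Y i ω)) μ := by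
    have h := integrable_exp_mul_sq_gaussianReal (l := l) (by linarith [(abs_le.1 hl).2])
    rw [← hlaw i] at h
    exact h.comp_measurable (hU i)
  have hmgf (l : ℝ) (hl : |l| ≤ 1 / 4) : mgf (∑ i, Y i) μ l ≤ Real.exp (n * (4 * l ^ 2)) := by
    rw [hYind.mgf_sum hY, Real.exp_nat_mul]
    calc _ ≤ ∏ i : Fin n, Real.exp (4 * l ^ 2) := by
          refine Finset.prod_le_prod (fun i _ => mgf_nonneg) fun i _ => ?_
          refine le_of_eq_of_le ?_ (mgf_sq_sub_one_le hl)
          rw [← hlaw i, mgf_map (hU i).aemeasurable (by rw [hlaw i]; exact hmeas l)]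
          rfl
      _ = _ := by simp
  have hsum (ω : Ω) : (∑ i, Y i) ω = ∑ i, (U i ω ^ 2 - 1) := by simp [Y]
  -- The Chernoff parameter t/8 minimizes -λnt + 4nλ²; the lower tail uses -t/8.
  have hup : μ.real {ω | n * t ≤ (∑ i, Y i) ω} ≤ Real.exp (-(n * t ^ 2 / 16)) := by
    have hl : |t / 8| ≤ 1 / 4 := by rw [abs_of_nonneg (by positivity)]; linarith
    refine (measure_ge_le_exp_mul_mgf (n * t) (by positivity : 0 ≤ t / 8)
      (hYind.integrable_exp_mul_sum hY fun i _ => hint _ hl i)).trans ?_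
    refine (mul_le_mul_of_nonneg_left (hmgf _ hl) (Real.exp_nonneg _)).trans ?_
    rw [← Real.exp_add]
    refine Real.exp_le_exp.2 (le_of_eq ?_)
    ring
  have hdown : μ.real {ω | (∑ i, Y i) ω ≤ -(n * t)} ≤ Real.exp (-(n * t ^ 2 / 16)) := by
    have hl : |-(t / 8)| ≤ 1 / 4 := by rw [abs_neg, abs_of_nonneg (by positivity)]; linarith
    refine (measure_le_le_exp_mul_mgf (-(n * t)) (by linarith : -(t / 8) ≤ 0)
      (hYind.integrable_exp_mul_sum hY fun i _ => hint _ hl i)).trans ?_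
    refine (mul_le_mul_of_nonneg_left (hmgf _ hl) (Real.exp_nonneg _)).trans ?_
    rw [← Real.exp_add]
    refine Real.exp_le_exp.2 (le_of_eq ?_)
    ring
  have hsub : {ω | n * t ≤ |∑ i, (U i ω ^ 2 - 1)|} ⊆
      {ω | n * t ≤ (∑ i, Y i) ω} ∪ {ω | (∑ i, Y i) ω ≤ -(n * t)} := by
    intro ω hω
    rcases le_abs.1 (show _ ≤ |∑ i, (U i ω ^ 2 - 1)| from hω) with h | h
    · left
      change n * t ≤ (∑ i, Y i) ω
      rwa [hsum]
    · right
      change (∑ i, Y i) ω ≤ -(n * t)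
      rw [hsum]
      linarith
  calc _ ≤ _ := measureReal_mono hsub
    _ ≤ _ := measureReal_union_le _ _
    _ ≤ _ := by linarith

/-! ### Spectral concentration of the sample covariance. -/

theorem map_inner_multivariateGaussian {p : ℕ} {Q : Mat p} (hQ : Q.PosSemidef)
    (z : EuclideanSpace ℝ (Fin p)) (hz : z.ofLp ⬝ᵥ Q *ᵥ z.ofLp = 1) :
    (multivariateGaussian 0 Q).map (fun x => inner ℝ z x) = gaussianReal 0 1 := by
  have h := IsGaussian.map_eq_gaussianReal (μ := multivariateGaussian 0 Q) (innerSL ℝ z)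
  have h1 : (∫ x, innerSL ℝ z x ∂(multivariateGaussian 0 Q)) = 0 := by
    rw [(innerSL ℝ z).integral_comp_id_comm IsGaussian.integrable_id,
      integral_id_multivariateGaussian, map_zero]
  have h2 : Var[innerSL ℝ z; multivariateGaussian 0 Q] = 1 := by
    have := covarianceBilin_self (μ := multivariateGaussian 0 Q) IsGaussian.memLp_two_id z
    rw [covarianceBilin_multivariateGaussian hQ, hz] at this
    exact this.symm
  rw [h1, h2, Real.toNNReal_one] at h
  exact h

theorem dotProduct_sampleCov_mulVec {p n : ℕ} (x : Fin n → EuclideanSpace ℝ (Fin p))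
    (y : EuclideanSpace ℝ (Fin p)) :
    y.ofLp ⬝ᵥ sampleCov x *ᵥ y.ofLp = 1 / n * ∑ i, inner ℝ y (x i) ^ 2 := by
  have e (i : Fin n) : inner ℝ y (x i) = (x i).ofLp ⬝ᵥ y.ofLp := by
    simp [PiLp.inner_apply, dotProduct]
  simp only [sampleCov, Matrix.smul_mulVec, Matrix.sum_mulVec, dotProduct_smul, dotProduct_sum,
    smul_eq_mul, Matrix.vecMulVec_mulVec, e]
  congr 1
  refine Finset.sum_congr rfl fun i _ => ?_
  rw [dotProduct_comm y.ofLp]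
  simp [sq]

theorem isSymm_sampleCov {p n : ℕ} (x : Fin n → EuclideanSpace ℝ (Fin p)) :
    (sampleCov x).IsSymm := by
  refine Matrix.IsSymm.smul ?_ _
  rw [Matrix.IsSymm, Matrix.transpose_sum]
  simp [Matrix.transpose_vecMulVec]

/-- Concentration of the quadratic form of the sample covariance matrix in one direction. -/
theorem quadForm_concentration {p n : ℕ} (hn : 0 < n) {Q : Mat p} (hQ : Q.PosDef)
    {X : Fin n → Ω → EuclideanSpace ℝ (Fin p)} (hX : ∀ i, Measurable (X i)) (hind : iIndepFun X μ)
    (hlaw : ∀ i, μ.map (X i) = multivariateGaussian 0 Q) {t : ℝ} (ht0 : 0 ≤ t)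
    (ht1 : t ≤ 1) {y : EuclideanSpace ℝ (Fin p)} (hy : y ≠ 0) :
    μ.real {ω | t * (y.ofLp ⬝ᵥ Q *ᵥ y.ofLp) ≤
      |y.ofLp ⬝ᵥ (sampleCov (fun i => X i ω) - Q) *ᵥ y.ofLp|} ≤
      2 * Real.exp (-(n * t ^ 2 / 16)) := by
  set v := y.ofLp ⬝ᵥ Q *ᵥ y.ofLp with hv
  have hv0 : 0 < v := by
    have := hQ.dotProduct_mulVec_pos (x := y.ofLp) (by simpa using hy)
    simpa using this
  set z := (Real.sqrt v)⁻¹ • y with hz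
  have hsv : 0 < Real.sqrt v := Real.sqrt_pos.2 hv0
  have hsq : Real.sqrt v ^ 2 = v := Real.sq_sqrt hv0.le
  have hz1 : z.ofLp ⬝ᵥ Q *ᵥ z.ofLp = 1 := by
    simp only [hz, WithLp.ofLp_smul, Matrix.mulVec_smul, dotProduct_smul, smul_dotProduct,
      smul_eq_mul, ← hv]
    field_simp
    exact hsq.symm
  have hm : Measurable fun x : EuclideanSpace ℝ (Fin p) => inner ℝ z x := by fun_prop
  have h := chiSquare_concentration (μ := μ) (U := fun i ω => inner ℝ z (X i ω))
    (fun i => hm.comp (hX i)) (hind.comp (fun _ x => inner ℝ z x) fun _ => hm)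
    (fun i => by
      rw [← map_inner_multivariateGaussian hQ.posSemidef z hz1, ← hlaw i,
        Measure.map_map hm (hX i)]
      rfl) ht0 ht1
  refine le_trans (measureReal_mono ?_) h
  intro ω hω
  change t * v ≤ _ at hω
  change n * t ≤ _
  have hn' : (0 : ℝ) < n := by exact_mod_cast hn
  have e : y.ofLp ⬝ᵥ (sampleCov (fun i => X i ω) - Q) *ᵥ y.ofLp =
      v / n * ∑ i, (inner ℝ z (X i ω) ^ 2 - 1) := by
    rw [Matrix.sub_mulVec, dotProduct_sub, dotProduct_sampleCov_mulVec, ← hv,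
      Finset.sum_sub_distrib, mul_sub]
    simp only [hz, real_inner_smul_left, mul_pow, ← Finset.mul_sum, inv_pow, hsq]
    simp
    field_simp
  rw [e, abs_mul, abs_of_pos (by positivity)] at hω
  rw [div_mul_eq_mul_div, le_div_iff₀ hn'] at hω
  refine le_of_mul_le_mul_left ?_ hv0
  linarith

theorem isSelfAdjoint_inner_toEuclideanCLM {p : ℕ} {A : Mat p} (hA : A.IsSymm)
    (x y : EuclideanSpace ℝ (Fin p)) :
    inner ℝ (Matrix.toEuclideanCLM (n := Fin p) (𝕜 := ℝ) A x) y =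
      inner ℝ x (Matrix.toEuclideanCLM (n := Fin p) (𝕜 := ℝ) A y) := by
  rw [real_inner_comm, Matrix.inner_toEuclideanCLM, Matrix.inner_toEuclideanCLM,
    Matrix.dotProduct_mulVec, dotProduct_comm, ← Matrix.mulVec_transpose, hA.eq]

/-- Concentration of the sample covariance matrix in spectral norm. -/
theorem sampleCov_concentration {p n : ℕ} (hp : 1 ≤ p) (hn : 49 * p ≤ n) {Q : Mat p}
    (hQ : Q.PosDef) {κ : ℝ} (hκ : (κ • (1 : Mat p) - Q).PosSemidef)
    {X : Fin n → Ω → EuclideanSpace ℝ (Fin p)} (hX : ∀ i, Measurable (X i)) (hind : iIndepFun X μ)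
    (hlaw : ∀ i, μ.map (X i) = multivariateGaussian 0 Q) :
    ∃ E : Set Ω, MeasurableSet E ∧ 1 - 2 * Real.exp (-(p : ℝ)) ≤ μ.real E ∧
      ∀ ω ∈ E, specNorm (sampleCov (fun i => X i ω) - Q) ≤
        32 * (7 * Real.sqrt (p / n) * κ) := by
  obtain ⟨N, hcard, hN1, hnet⟩ := exists_sphere_net p
  have hn0 : 0 < n := by omega
  have hn' : (0 : ℝ) < n := by exact_mod_cast hn0
  have hp' : (0 : ℝ) < p := by exact_mod_cast hp
  have hpn : 49 * (p : ℝ) ≤ n := by exact_mod_cast hn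
  -- The factor 7 makes nt²/16 = 49p/16 ≥ 3p, which beats the net size 5^p ≤ e^{2p} and leaves
  -- e^{-p}. The condition n ≥ 49p is exactly t ≤ 1.
  set t := 7 * Real.sqrt (p / n) with ht
  have ht0 : 0 ≤ t := by positivity
  have htsq : n * t ^ 2 = 49 * p := by
    rw [ht, mul_pow, Real.sq_sqrt (by positivity)]
    field_simp
    norm_num
  have ht1 : t ≤ 1 := by
    refine (abs_le_of_sq_le_sq' ?_ zero_le_one).2
    rw [one_pow]
    refine le_of_mul_le_mul_left ?_ hn'
    linarith
  let B : EuclideanSpace ℝ (Fin p) → Set Ω := fun y =>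
    {ω | t * (y.ofLp ⬝ᵥ Q *ᵥ y.ofLp) ≤
      |y.ofLp ⬝ᵥ (sampleCov (fun i => X i ω) - Q) *ᵥ y.ofLp|}
  have hBmeas (y) : MeasurableSet (B y) := by
    refine measurableSet_le measurable_const (Measurable.abs ?_)
    simp only [Matrix.sub_mulVec, dotProduct_sub, dotProduct_sampleCov_mulVec]
    refine Measurable.sub_const (Measurable.const_mul (Finset.measurable_sum _ fun i _ => ?_) _) _
    have hm : Measurable fun x : EuclideanSpace ℝ (Fin p) => inner ℝ y x := by fun_prop
    exact (hm.comp (hX i)).pow_const 2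
  have hbad : μ.real (⋃ y ∈ N, B y) ≤ 2 * Real.exp (-(p : ℝ)) := by
    calc μ.real (⋃ y ∈ N, B y) ≤ ∑ y ∈ N, μ.real (B y) := measureReal_biUnion_finset_le _ _
      _ ≤ ∑ y ∈ N, 2 * Real.exp (-(n * t ^ 2 / 16)) := by
          refine Finset.sum_le_sum fun y hy => ?_
          refine quadForm_concentration hn0 hQ hX hind hlaw ht0 ht1 ?_
          rintro rfl
          simpa using hN1 0 hy
      _ = N.card * (2 * Real.exp (-(n * t ^ 2 / 16))) := by simp
      _ ≤ Real.exp (2 * p) * (2 * Real.exp (-(3 * p))) := by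
          gcongr
          · calc (N.card : ℝ) ≤ 5 ^ p := by exact_mod_cast hcard
              _ ≤ Real.exp 2 ^ p := by
                  gcongr
                  have := Real.exp_one_gt_d9
                  rw [show (2 : ℝ) = 1 + 1 by norm_num, Real.exp_add]
                  nlinarith
              _ = Real.exp (2 * p) := by rw [← Real.exp_nat_mul]; ring_nf
          · linarith
      _ = 2 * Real.exp (-(p : ℝ)) := by
          rw [mul_left_comm, ← Real.exp_add]
          ring_nf
  refine ⟨(⋃ y ∈ N, B y)ᶜ, (N.measurableSet_biUnion fun y _ => hBmeas y).compl, ?_, ?_⟩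
  · rw [probReal_compl_eq_one_sub (N.measurableSet_biUnion fun y _ => hBmeas y)]
    linarith
  · intro ω hω
    have hκ0 (y : EuclideanSpace ℝ (Fin p)) (hy : ‖y‖ = 1) : y.ofLp ⬝ᵥ Q *ᵥ y.ofLp ≤ κ := by
      have h1 := hκ.dotProduct_mulVec_nonneg y.ofLp
      have h2 : y.ofLp ⬝ᵥ y.ofLp = 1 := by
        have := EuclideanSpace.real_norm_sq_eq y
        rw [hy] at this
        simp only [dotProduct, ← sq]
        rw [← this, one_pow]
      simp only [star_trivial, Matrix.sub_mulVec, Matrix.smul_mulVec, Matrix.one_mulVec,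
        dotProduct_sub, dotProduct_smul, smul_eq_mul, h2] at h1
      linarith
    have hsymm : (sampleCov (fun i => X i ω) - Q).IsSymm :=
      (isSymm_sampleCov _).sub (by simpa [Matrix.IsSymm] using hQ.1)
    have hκ1 : 0 ≤ κ := by
      have h1 := hκ0 (EuclideanSpace.single ⟨0, hp⟩ 1) (by simp)
      have h2 := hQ.posSemidef.dotProduct_mulVec_nonneg
        (EuclideanSpace.single (⟨0, hp⟩ : Fin p) (1 : ℝ)).ofLp
      rw [star_trivial] at h2
      exact h2.trans h1
    refine norm_le_of_net (isSelfAdjoint_inner_toEuclideanCLM hsymm) (N := (N : Set _)) hN1 hnet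
      (mul_nonneg ht0 hκ1) fun y hy => ?_
    have hy' : ω ∉ B y := fun h => hω (Set.mem_biUnion hy h)
    have h1 : |y.ofLp ⬝ᵥ (sampleCov (fun i => X i ω) - Q) *ᵥ y.ofLp| <
        t * (y.ofLp ⬝ᵥ Q *ᵥ y.ofLp) := not_le.1 hy'
    rw [real_inner_comm, Matrix.inner_toEuclideanCLM]
    exact h1.le.trans (mul_le_mul_of_nonneg_left (hκ0 y (hN1 y hy)) ht0)

end Chernoff

/-! ### Scalar consequences of the assumptions and the main theorem -/

theorem ratio_bound {lo hi ρ₀ : ℝ} (hhi : 0 < hi) (hρ0 : 0 < ρ₀) (hρ1 : ρ₀ < 1 / 2)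
    (h : hi ≤ 1 / Real.sqrt (1 - ρ₀ ^ 2) * lo) : 3 / 4 * hi ^ 2 ≤ lo ^ 2 := by
  have h1 : 3 / 4 ≤ 1 - ρ₀ ^ 2 := by nlinarith
  have hw := Real.sqrt_pos.2 (by linarith : 0 < 1 - ρ₀ ^ 2)
  have h2 : Real.sqrt (1 - ρ₀ ^ 2) * hi ≤ lo := by
    rw [one_div, ← div_eq_inv_mul, le_div_iff₀ hw] at h
    linarith
  calc 3 / 4 * hi ^ 2 ≤ (1 - ρ₀ ^ 2) * hi ^ 2 := by gcongr
    _ = (Real.sqrt (1 - ρ₀ ^ 2) * hi) ^ 2 := by rw [mul_pow, Real.sq_sqrt (by linarith)]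
    _ ≤ lo ^ 2 := by gcongr

/-- The sample size bound controls the dimension and the statistical error. -/
theorem sampleSize_consequences {p r n : ℕ} (hp : 1 ≤ p) (hr : 1 ≤ r) {δ q : ℝ} (hδ : 0 < δ)
    (hδ2 : δ ^ 2 < 2) (hq : 1 ≤ q) (hn : 4000000 * (1 / δ ^ 2 * q ^ 2 * (r * p)) ≤ n) :
    49 * p ≤ n ∧ 2000 * q * Real.sqrt (r * p / n) ≤ δ := by
  have hp' : (1 : ℝ) ≤ p := by exact_mod_cast hp
  have hr' : (1 : ℝ) ≤ r := by exact_mod_cast hr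
  have hδ0 : 0 < δ ^ 2 := by positivity
  have h1 : 4000000 * q ^ 2 * (r * p) ≤ n * δ ^ 2 := by
    calc 4000000 * q ^ 2 * (r * p) = 4000000 * (1 / δ ^ 2 * q ^ 2 * (r * p)) * δ ^ 2 := by
          field_simp
      _ ≤ n * δ ^ 2 := by gcongr
  have h2 : (p : ℝ) ≤ q ^ 2 * (r * p) := by
    have h3 : (1 : ℝ) ≤ q ^ 2 * r := by nlinarith
    nlinarith
  have hn0 : (0 : ℝ) ≤ n := Nat.cast_nonneg n
  have h3 : 49 * (p : ℝ) ≤ n := by nlinarith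
  have hn1 : (0 : ℝ) < n := by linarith
  refine ⟨by exact_mod_cast h3, ?_⟩
  refine (abs_le_of_sq_le_sq' ?_ hδ.le).2
  rw [mul_pow, Real.sq_sqrt (by positivity), ← mul_div_assoc, div_le_iff₀ hn1]
  linarith

/-- Here lo cancels: 4 · 32 · 7 = 896, and √(2r) ≤ 2√r gives 1792 ≤ 2000. -/
theorem noise_le {p r n : ℕ} {lo γ ρ₁ ρ₂ : ℝ} (hlo : 0 < lo) (hρ₁ : ρ₁ < 1) (hρ₂ : 0 ≤ ρ₂)
    (hγ : γ ≤ 32 * (7 * Real.sqrt (p / n) * lo⁻¹)) :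
    ρ₂ * (4 * lo * (Real.sqrt (2 * r) * γ)) ≤
      (1 - ρ₁) * (2000 * ρ₂ / (1 - ρ₁) * Real.sqrt (r * p / n)) := by
  have h1 : Real.sqrt (2 * r) ≤ 2 * Real.sqrt r := by
    rw [show (2 : ℝ) * Real.sqrt r = Real.sqrt (2 ^ 2 * r) by
      rw [Real.sqrt_mul (by positivity), Real.sqrt_sq zero_le_two]]
    gcongr
    norm_num
  have h2 : Real.sqrt (r * p / n) = Real.sqrt r * Real.sqrt (p / n) := by
    rw [mul_div_assoc, Real.sqrt_mul (Nat.cast_nonneg r)]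
  have h3 : (1 - ρ₁) * (2000 * ρ₂ / (1 - ρ₁) * Real.sqrt (r * p / n)) =
      ρ₂ * (2000 * (Real.sqrt r * Real.sqrt (p / n))) := by
    have : 1 - ρ₁ ≠ 0 := by linarith
    rw [h2]
    field_simp
  rw [h3]
  refine mul_le_mul_of_nonneg_left ?_ hρ₂
  have h4 : 0 ≤ Real.sqrt r * Real.sqrt (p / n) := by positivity
  calc 4 * lo * (Real.sqrt (2 * r) * γ)
      ≤ 4 * lo * (Real.sqrt (2 * r) * (32 * (7 * Real.sqrt (p / n) * lo⁻¹))) := by gcongr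
    _ = 896 * (Real.sqrt (2 * r) * Real.sqrt (p / n)) := by
        linear_combination (896 * (Real.sqrt (2 * r) * Real.sqrt (p / n))) * mul_inv_cancel₀ hlo.ne'
    _ ≤ 896 * (2 * Real.sqrt r * Real.sqrt (p / n)) := by gcongr
    _ ≤ _ := by linarith

end LVM

end

theorem theorem4 :
    ∃ c₃ : ℝ, 0 < c₃ ∧ ∃ C₀ : ℝ, 0 < C₀ ∧
    ∀ (p r n : ℕ), 1 ≤ p → 1 ≤ r →
    -- the true matrices
    ∀ (S Lstar : LVM.Mat p), S.PosDef → Lstar.PosSemidef → Lstar.rank ≤ r →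
    -- projection constants, slack parameters and step size
    ∀ (cT cH δ a η : ℝ), 1 < cT → 0 < cH → cH < 1 → 0 < δ → 0 < a →
    a ≤ (1 + Real.sqrt r) * LVM.specNorm Lstar + δ →
    -- the bounds on the spectrum and the constants `m`, `M`
    ∀ (S₁ Sₚ lo hi m M : ℝ), S₁ = LVM.lamMax S → Sₚ = LVM.lamMin S →
    lo = Sₚ - a → hi = S₁ + (1 + Real.sqrt r) * LVM.specNorm Lstar + δ →
    m = 1 / hi ^ 2 → M = 1 / lo ^ 2 →
    -- the parameters of the convergence rate, and the choice of the step size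
    ∀ (ρ₀ ρ₁ ρ₂ : ℝ), ρ₀ = LVM.rho0 cT cH m M → ρ₁ = LVM.rho1 cT cH m M η →
    ρ₂ = LVM.rho2 cT cH m M →
    0 < LVM.eta0 cH m M → ρ₁ < 1 →
    (1 - ρ₀ ^ 2) / M ≤ η → η ≤ (1 + ρ₀ ^ 2) / m →
    -- the number of samples
    C₀ * (1 / δ ^ 2 * (ρ₂ / (1 - ρ₁)) ^ 2 * (r * p)) ≤ n →
    -- the bound on the spectral norm of the low-rank part
    LVM.specNorm Lstar ≤ 1 / (1 + Real.sqrt r) *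
      (Sₚ / (1 + Real.sqrt (1 - ρ₀ ^ 2))
        - S₁ * Real.sqrt (1 - ρ₀ ^ 2) / (1 + Real.sqrt (1 - ρ₀ ^ 2))
        - c₃ * ρ₂ / (1 - ρ₁) * Real.sqrt (r * p / n)) →
    -- the eigenvalue condition
    S₁ ≤ 1 / Real.sqrt (1 - ρ₀ ^ 2) * (Sₚ - a)
        - (1 + Real.sqrt r) * LVM.specNorm Lstar - δ →
    -- the constants meet the requirement of the convergence theorem
    0 < lo ∧ 0 < m ∧ 1 ≤ M ^ 2 / m ^ 2 ∧ M ^ 2 / m ^ 2 ≤ 1 / (1 - ρ₀ ^ 2) ∧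
    -- with high probability they are RSC / RSS constants of `F` around all iterates
    ∀ (Ω : Type*) [MeasurableSpace Ω] (μ : Measure Ω) [IsProbabilityMeasure μ]
      (X : Fin n → Ω → EuclideanSpace ℝ (Fin p)),
      (∀ i, Measurable (X i)) → iIndepFun X μ →
      (∀ i, μ.map (X i) = multivariateGaussian 0 (S + Lstar)⁻¹) →
      ∃ E : Set Ω, MeasurableSet E ∧ 1 - 2 * Real.exp (-(p : ℝ)) ≤ μ.real E ∧
        ∀ ω ∈ E,
          LVM.RSCRSSOn (LVM.specBox S lo hi) (2 * r)
            (LVM.obj S (LVM.sampleCov fun i => X i ω))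
            (LVM.gradObj S (LVM.sampleCov fun i => X i ω)) m M ∧
          Lstar ∈ LVM.specBox S lo hi ∧
          ∀ L : ℕ → LVM.Mat p,
            LVM.IsAPLVMRun S (LVM.sampleCov fun i => X i ω) r η cT cH L →
            ∀ T : ℕ,
              ((1 + Real.sqrt r) * LVM.specNorm Lstar
                  + c₃ * ρ₂ / (1 - ρ₁) * Real.sqrt (r * p / n) ≤ a ∨
                ∀ t ≤ T, -a ≤ LVM.lamMin (L t)) →
              ∀ t ≤ T, L t ∈ LVM.specBox S lo hi := by
  -- c₃ = 2000 absorbs the noise constant, and C₀ = c₃² makes the statistical error ε at most δ'.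
  refine ⟨2000, by norm_num, 4000000, by norm_num, ?_⟩
  intro p r n hp hr S Lstar hS hLstar hrank cT cH δ a η hcT hcH0 hcH1 hδ ha _ S₁ Sₚ lo hi m M
    hS₁ hSₚ hlo hhi hm hM ρ₀ ρ₁ ρ₂ hρ₀ hρ₁ hρ₂ hη₀ hρ₁1 _ _ hn _ hcond
  subst hS₁ hSₚ hρ₀ hρ₁ hρ₂
  have hSs : S.IsSymm := by simpa [Matrix.IsSymm] using hS.1
  have hLs : Lstar.IsSymm := by simpa [Matrix.IsSymm] using hLstar.1
  have hspec := LVM.specNorm_nonneg Lstar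
  have hSp := LVM.lamMin_pos hp hS
  have hSpS := LVM.lamMin_le_lamMax hp hS
  have hsr : 0 ≤ Real.sqrt r * LVM.specNorm Lstar := mul_nonneg (Real.sqrt_nonneg _) hspec
  have hlohi : lo < hi := by rw [hlo, hhi]; linarith
  have hhi0 : 0 < hi := by rw [hhi]; linarith
  have hhilo : hi ≤ 1 / Real.sqrt (1 - LVM.rho0 cT cH m M ^ 2) * lo := by
    rw [hhi, hlo]
    linarith
  have hlo0 : 0 < lo :=
    pos_of_mul_pos_right (hhi0.trans_le hhilo) (by positivity)
  have hm0 : 0 < m := by rw [hm]; positivity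
  have hmM : m < M := by
    rw [hm, hM]
    exact one_div_lt_one_div_of_lt (by positivity) (by gcongr)
  have h34 := LVM.ratio_bound hhi0 (LVM.rho0_pos hcT hρ₁1) (LVM.rho0_lt_half hcT) hhilo
  have hδhi : δ < hi := by rw [hhi]; linarith
  -- Since δ < hi and hi² < 2, the sample size bound also implies n ≥ 49p.
  have hδ2 : δ ^ 2 < 2 := by
    have h1 := LVM.half_lt_of_eta0_pos hcH1 hm0 hmM hη₀
    have h2 : m * hi ^ 2 = 1 := by rw [hm]; field_simp
    nlinarith
  have hρ₂1 := LVM.one_le_rho2 hcT hη₀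
  have hρ₁0 := LVM.rho1_nonneg (cH := cH) (m := m) (M := M) (η := η) hcT
  have hq : 1 ≤ LVM.rho2 cT cH m M / (1 - LVM.rho1 cT cH m M η) := by
    rw [one_le_div (by linarith)]
    linarith
  obtain ⟨hnp, hεδ⟩ := LVM.sampleSize_consequences hp hr hδ hδ2 hq hn
  rw [← mul_div_assoc] at hεδ
  refine ⟨hlo0, hm0, ?_, LVM.sq_div_sq_le hcT hm0 (hm0.trans hmM) hρ₁1, ?_⟩
  · rw [one_le_div (by positivity)]
    gcongr
  intro Ω _ μ _ X hX hind hlaw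
  have hbox : Lstar ∈ LVM.specBox S lo hi := by
    rw [hlo]
    refine LVM.mem_specBox_of_frobNorm_le (d := 0) hSs hLstar hLs ?_ ?_ (Or.inl ha.le)
    · rw [sub_self, ← LVM.norm_toEuc, map_zero, norm_zero]
    · rw [hhi]
      linarith
  have hbtw : LVM.Between lo hi (S + Lstar) := hbox.2
  obtain ⟨E, hE, hEμ, hconc⟩ := LVM.sampleCov_concentration hp hnp (hbtw.posDef hlo0).inv
    (hbtw.inv hlo0 hhi0).2 hX hind hlaw
  refine ⟨E, hE, hEμ, fun ω hω => ⟨?_, hbox, fun L hL T hT => ?_⟩⟩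
  · rw [hm, hM]
    exact LVM.rscrssOn_obj hlo0 hlohi.le _
  · have hgrad : LVM.gradObj S (LVM.sampleCov fun i => X i ω) Lstar =
        LVM.sampleCov (fun i => X i ω) - (S + Lstar)⁻¹ := by
      rw [LVM.gradObj]
      abel
    have hG := hconc ω hω
    rw [← hgrad] at hG
    have hnoise := LVM.noise_le (r := r) hlo0 hρ₁1
      (by linarith : 0 ≤ LVM.rho2 cT cH m M) hG
    have hε : 0 ≤ 2000 * LVM.rho2 cT cH m M / (1 - LVM.rho1 cT cH m M η) *
        Real.sqrt (r * p / n) :=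
      mul_nonneg (div_nonneg (by linarith) (by linarith)) (Real.sqrt_nonneg _)
    subst hlo
    exact hL.mem_specBox hSs hLstar hrank hcT hcH0 hcH1 hlo0 hlohi h34 hm hM hη₀ hρ₁1 hbox
      hnoise hε (by rw [hhi]; linarith) T hT
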